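/- Let $d$ be an odd positive integer and $\ell=\sqrt{2\pi/d}$. For $\mathbf a=(\mathbf a_X,\mathbf a_Z)$ and $\mathbf b=(\mathbf b_X,\mathbf b_Z)$ in $\mathbb R^{2n}$ put $[\mathbf a,\mathbf b]=\mathbf a_X\cdot\mathbf b_Z-\mathbf a_Z\cdot\mathbf b_X$, and let $\hat T_{\mathbf a}=e^{i\pi\mathbf a_X\cdot\mathbf a_Z/d}\,e^{-i\ell\mathbf a_X\cdot\hat{\mathbf p}}\,e^{i\ell\mathbf a_Z\cdot\hat{\mathbf q}}$ on $L^2(\mathbb R^n)$, where $(e^{-i\mathbf s\cdot\hat{\mathbf p}}\psi)(\mathbf x)=\psi(\mathbf x-\mathbf s)$ and $(e^{i\mathbf t\cdot\hat{\mathbf q}}\psi)(\mathbf x)=e^{i\mathbf t\cdot\mathbf x}\psi(\mathbf x)$. The phase-point operator $$\hat A_{\boldsymbol\eta}=\frac1{(2\pi)^n}\sum_{\mathbf a\in\mathbb Z^{2n}}e^{i\ell[\mathbf a,\boldsymbol\eta]+i\pi\mathbf a_X\cdot\mathbf a_Z}\,\hat T_{\mathbf a}$$ is a generalised operator, given by its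 matrix elements $\langle f,\hat A_{\boldsymbol\eta}g\rangle=\frac1{(2\pi)^n}\sum_{\mathbf a}e^{i\ell[\mathbf a,\boldsymbol\eta]+i\pi\mathbf a_X\cdot\mathbf a_Z}\langle f,\hat T_{\mathbf a}g\rangle$ for all pairs $f,g\in L^2(\mathbb R^n)$ for which the series converges absolutely; write $(f,g)\in\mathcal D_n$ for such pairs. For a state (density operator) $\hat\rho$ on $L^2(\mathbb R^n)$ the Zak-Gross Wigner function is $$W_{\hat\rho}(\boldsymbol\eta)=\operatorname{Tr}(\hat\rho\hat A_{\boldsymbol\eta})=\frac1{(2\pi)^n}\sum_{\mathbf a\in\mathbb Z^{2n}}e^{i\ell[\mathbf a,\boldsymbol\eta]+i\pi\mathbf a_X\cdot\mathbf a_Z}\operatorname{Tr}(\hat\rho\hat T_{\mathbf a}),\qquad\boldsymbol\eta\in[0,d\ell)^{2n}.$$ It is the sum of this series if the series converges absolutely (the formula then makes sense for every $\boldsymbol\eta\in\mathbb R^{2n}$), and otherwise the integrable function on $[0,d\ell)^{2n}$, unique up to null sets, whose Fourier series this is. Its negativity (negative volume) is $\mathcal M_{\hat\rho}=\int_{[0,d\ell)^{2n}}|W_{\hat\rho}(\boldsymbol\eta)|\,d\boldsymbol\eta$.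 Let $n=m+m'$, identify $L^2(\mathbb R^m)\otimes L^2(\mathbb R^{m'})$ with $L^2(\mathbb R^n)$, and for $\boldsymbol\eta\in\mathbb R^{2n}$ let $\boldsymbol\eta^{(1)}\in\mathbb R^{2m}$ and $\boldsymbol\eta^{(2)}\in\mathbb R^{2m'}$ be its parts that belong to the first $m$ and to the last $m'$ modes. Then: 1. $\hat A_{\boldsymbol\eta}=\hat A_{\boldsymbol\eta^{(1)}}\otimes\hat A_{\boldsymbol\eta^{(2)}}$ for all $\boldsymbol\eta$. That is: for any number of modes all pairs of Schwartz functions have matrix elements; if $(f_1,g_1)\in\mathcal D_m$ and $(f_2,g_2)\in\mathcal D_{m'}$, then $(f_1\otimes f_2,g_1\otimes g_2)\in\mathcal D_n$ and $$\langle f_1\otimes f_2,\hat A_{\boldsymbol\eta}(g_1\otimes g_2)\rangle=\langle f_1,\hat A_{\boldsymbol\eta^{(1)}}g_1\rangle\,\langle f_2,\hat A_{\boldsymbol\eta^{(2)}}g_2\rangle;$$ and for every $(F,G)\in\mathcal D_n$, $\langle F,\hat A_{\boldsymbol\eta}G\rangle$ is the limit of $\langle F,(\hat A^{S_1}_{\boldsymbol\eta^{(1)}}\otimes\hat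 A^{S_2}_{\boldsymbol\eta^{(2)}})G\rangle$ as the finite sets $S_1\subset\mathbb Z^{2m}$, $S_2\subset\mathbb Z^{2m'}$ increase, where $\hat A^{S}_{\boldsymbol\eta}$ is the partial sum of the series of $\hat A_{\boldsymbol\eta}$ over $\mathbf a\in S$. 2. For all states $\hat\rho$ on $m$ modes and $\hat\sigma$ on $m'$ modes, $$W_{\hat\rho\otimes\hat\sigma}(\boldsymbol\eta)=W_{\hat\rho}(\boldsymbol\eta^{(1)})\,W_{\hat\sigma}(\boldsymbol\eta^{(2)})$$ for almost every $\boldsymbol\eta\in[0,d\ell)^{2n}$; if the series of $W_{\hat\rho}$ and $W_{\hat\sigma}$ converge absolutely, then so does that of $W_{\hat\rho\otimes\hat\sigma}$, and the identity holds for every $\boldsymbol\eta\in\mathbb R^{2n}$. 3. The negativity is multiplicative: $\mathcal M_{\hat\rho\otimes\hat\sigma}=\mathcal M_{\hat\rho}\,\mathcal M_{\hat\sigma}$ for all states $\hat\rho$ on $m$ modes and $\hat\sigma$ on $m'$ modes. -/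

import Mathlib

open MeasureTheory Filter Topology
open scoped InnerProductSpace TensorProduct SchwartzMap

noncomputable section

namespace ZakGross

/-! ### Configuration space, phase space and Hilbert space of `n` modes -/

/-- The Hilbert space `L²(ℝⁿ)` of `n` bosonic modes, in the position representation. -/
abbrev Hilb (n : ℕ) : Type := Lp ℂ 2 (volume : Measure (Fin n → ℝ))

/-- Pairs `a = (a_X, a_Z)` of vectors of length `n`, i.e. vectors of length `2n`. -/
abbrev Phase (R : Type) (n : ℕ) : Type := (Fin n → R) × (Fin n → R)

/-- The symplectic form `[a, b] = a_X · b_Z - a_Z · b_X`. -/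
def symp {n : ℕ} (a b : Phase ℝ n) : ℝ := a.1 ⬝ᵥ b.2 - a.2 ⬝ᵥ b.1

/-- An integer vector, seen as a real vector. -/
def toReal {n : ℕ} (a : Phase ℤ n) : Phase ℝ n := (fun i => (a.1 i : ℝ), fun i => (a.2 i : ℝ))

/-- The first `m` entries of a vector of length `m + k`. -/
def left {R : Type} {m k : ℕ} (x : Fin (m + k) → R) : Fin m → R := fun i => x (Fin.castAdd k i)

/-- The last `k` entries of a vector of length `m + k`. -/
def right {R : Type} {m k : ℕ} (x : Fin (m + k) → R) : Fin k → R := fun j => x (Fin.natAdd m j)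

/-- The part `η⁽¹⁾` of a phase-space vector that belongs to the first `m` of `m + k` modes. -/
def fstModes {R : Type} {m k : ℕ} (η : Phase R (m + k)) : Phase R m := (left η.1, left η.2)

/-- The part `η⁽²⁾` of a phase-space vector that belongs to the last `k` of `m + k` modes. -/
def sndModes {R : Type} {m k : ℕ} (η : Phase R (m + k)) : Phase R k := (right η.1, right η.2)

/-- The lattice constant `ℓ = √(2π/d)`. -/
def ell (d : ℕ) : ℝ := Real.sqrt (2 * Real.pi / d)

/-- The domain `[0, dℓ)^{2n}` of the Zak-Gross Wigner function. -/
def cell (d n : ℕ) : Set (Phase ℝ n) :=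
  {η | (∀ i, η.1 i ∈ Set.Ico 0 (d * ell d)) ∧ ∀ i, η.2 i ∈ Set.Ico 0 (d * ell d)}

/-! ### Displacement operators -/

/-- `exp(-i s · p̂)`, which acts on wave functions by `ψ ↦ ψ(· - s)`. -/
def translation {n : ℕ} (s : Fin n → ℝ) : Hilb n →L[ℂ] Hilb n :=
  (Lp.compMeasurePreservingₗᵢ ℂ (fun x : Fin n → ℝ => x - s)
    (measurePreserving_sub_right volume s)).toContinuousLinearMap

theorem memLp_modulation {n : ℕ} (t : Fin n → ℝ) (f : Hilb n) :
    MemLp (fun x : Fin n → ℝ => Complex.exp (Complex.I * ((t ⬝ᵥ x : ℝ) : ℂ)) * f x) 2 volume := by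
  refine (Lp.memLp f).of_le_mul (c := 1) ?_ ?_
  · refine AEStronglyMeasurable.mul ?_ (Lp.aestronglyMeasurable f)
    refine Continuous.aestronglyMeasurable ?_
    unfold dotProduct
    fun_prop
  · refine Eventually.of_forall fun x => ?_
    rw [norm_mul, mul_comm Complex.I, Complex.norm_exp_ofReal_mul_I]

/-- `exp(i t · q̂)`, which acts on wave functions by multiplication with `exp(i t · x)`. -/
def modulation {n : ℕ} (t : Fin n → ℝ) : Hilb n →L[ℂ] Hilb n :=
  LinearMap.mkContinuous
    { toFun := fun f => (memLp_modulation t f).toLp _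
      map_add' := fun f g => by
        rw [← MemLp.toLp_add, MemLp.toLp_eq_toLp_iff]
        filter_upwards [Lp.coeFn_add f g] with x hx
        simp only [hx, Pi.add_apply, mul_add]
      map_smul' := fun c f => by
        rw [RingHom.id_apply, ← MemLp.toLp_const_smul, MemLp.toLp_eq_toLp_iff]
        filter_upwards [Lp.coeFn_smul c f] with x hx
        simp only [hx, Pi.smul_apply, smul_eq_mul]
        ring }
    1 fun f => by
      rw [one_mul]
      refine Lp.norm_le_norm_of_ae_le ?_
      filter_upwards [(memLp_modulation t f).coeFn_toLp] with x hx
      simp only [LinearMap.coe_mk, AddHom.coe_mk]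
      rw [hx, norm_mul, mul_comm Complex.I, Complex.norm_exp_ofReal_mul_I, one_mul]

/-- The operators `T_a = exp(iπ a_X·a_Z/d) exp(-iℓ a_X·p̂) exp(iℓ a_Z·q̂)`, i.e. the displacement
operators `D(-ℓa)`. -/
def T {n : ℕ} (d : ℕ) (a : Phase ℝ n) : Hilb n →L[ℂ] Hilb n :=
  Complex.exp (Complex.I * ((Real.pi * (a.1 ⬝ᵥ a.2) / d : ℝ) : ℂ)) •
    (translation (ell d • a.1) ∘L modulation (ell d • a.2))

/-! ### The phase-point operators -/

/-- The coefficient `exp(iℓ[a, η] + iπ a_X · a_Z)`. -/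
def phaseCoeff {n : ℕ} (d : ℕ) (η : Phase ℝ n) (a : Phase ℤ n) : ℂ :=
  Complex.exp (Complex.I *
    ((ell d * symp (toReal a) η + Real.pi * ((toReal a).1 ⬝ᵥ (toReal a).2) : ℝ) : ℂ))

/-- The finite truncation `(2π)⁻ⁿ ∑_{a ∈ S} exp(iℓ[a, η] + iπ a_X · a_Z) T_a` of the phase-point
operator, a bounded operator. -/
def phasePointTrunc {n : ℕ} (d : ℕ) (η : Phase ℝ n) (S : Finset (Phase ℤ n)) :
    Hilb n →L[ℂ] Hilb n :=
  (1 / (2 * (Real.pi : ℂ)) ^ n) • ∑ a ∈ S, phaseCoeff d η a • T d (toReal a)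

/-- The pairs of vectors between which the phase-point operators have matrix elements: the series
that defines the matrix element converges absolutely. -/
def InFormDomain {n : ℕ} (d : ℕ) (f g : Hilb n) : Prop :=
  Summable fun a : Phase ℤ n => ⟪f, T d (toReal a) g⟫_ℂ

/-- The phase-point operator
`A_η = (2π)⁻ⁿ ∑_{a ∈ ℤ²ⁿ} exp(iℓ[a, η] + iπ a_X · a_Z) T_a`.
The series does not converge to an operator on `L²(ℝⁿ)`: like the ideal GKP states it is a
generalised operator, given by its matrix elements `⟨f, A_η g⟩`. -/
def phasePoint {n : ℕ} (d : ℕ) (η : Phase ℝ n) (f g : Hilb n) : ℂ :=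
  1 / (2 * (Real.pi : ℂ)) ^ n *
    ∑' a : Phase ℤ n, phaseCoeff d η a * ⟪f, T d (toReal a) g⟫_ℂ

/-! ### Tensor products -/

theorem measurePreserving_split (m k : ℕ) :
    MeasurePreserving (fun x : Fin (m + k) → ℝ => ((left x, right x) : (Fin m → ℝ) × (Fin k → ℝ)))
      volume volume := by
  have h := (volume_measurePreserving_sumPiEquivProdPi (fun _ : Fin m ⊕ Fin k => ℝ)).comp
    (volume_measurePreserving_piCongrLeft (fun _ : Fin m ⊕ Fin k => ℝ) finSumFinEquiv.symm)
  convert h using 1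
  funext x
  refine Prod.ext (funext fun i => ?_) (funext fun j => ?_)
  · have := MeasurableEquiv.piCongrLeft_apply_apply (β := fun _ : Fin m ⊕ Fin k => ℝ)
      finSumFinEquiv.symm x (Fin.castAdd k i)
    simp only [finSumFinEquiv_symm_apply_castAdd] at this
    exact this.symm
  · have := MeasurableEquiv.piCongrLeft_apply_apply (β := fun _ : Fin m ⊕ Fin k => ℝ)
      finSumFinEquiv.symm x (Fin.natAdd m j)
    simp only [finSumFinEquiv_symm_apply_natAdd] at this
    exact this.symm

theorem memLp_tensor {m k : ℕ} (f : Hilb m) (g : Hilb k) :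
    MemLp (fun x : Fin (m + k) → ℝ => f (left x) * g (right x)) 2 volume := by
  have h : MemLp (fun p : (Fin m → ℝ) × (Fin k → ℝ) => f p.1 * g p.2) 2 volume := by
    have hm : AEStronglyMeasurable (fun p : (Fin m → ℝ) × (Fin k → ℝ) => f p.1 * g p.2)
        volume := (Lp.aestronglyMeasurable f).comp_fst.mul (Lp.aestronglyMeasurable g).comp_snd
    rw [memLp_two_iff_integrable_sq_norm hm]
    have := ((memLp_two_iff_integrable_sq_norm (Lp.aestronglyMeasurable f)).1
      (Lp.memLp f)).mul_prod
      ((memLp_two_iff_integrable_sq_norm (Lp.aestronglyMeasurable g)).1 (Lp.memLp g))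
    rw [Measure.volume_eq_prod]
    simpa only [norm_mul, mul_pow] using this
  exact h.comp_measurePreserving (measurePreserving_split m k)

/-- The product vector `f ⊗ g`, i.e. the wave function `(x, y) ↦ f(x) g(y)`. -/
def tensorVec {m k : ℕ} (f : Hilb m) (g : Hilb k) : Hilb (m + k) := (memLp_tensor f g).toLp _

theorem coeFn_tensorVec {m k : ℕ} (f : Hilb m) (g : Hilb k) :
    tensorVec f g =ᵐ[volume] fun x => f (left x) * g (right x) :=
  (memLp_tensor f g).coeFn_toLp

theorem quasi_left (m k : ℕ) : Measure.QuasiMeasurePreserving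
    (left : (Fin (m + k) → ℝ) → (Fin m → ℝ)) volume volume :=
  Measure.quasiMeasurePreserving_fst.comp (measurePreserving_split m k).quasiMeasurePreserving

theorem quasi_right (m k : ℕ) : Measure.QuasiMeasurePreserving
    (right : (Fin (m + k) → ℝ) → (Fin k → ℝ)) volume volume :=
  Measure.quasiMeasurePreserving_snd.comp (measurePreserving_split m k).quasiMeasurePreserving

/-- The bilinear map `(f, g) ↦ f ⊗ g`. -/
def tensorBilin (m k : ℕ) : Hilb m →ₗ[ℂ] Hilb k →ₗ[ℂ] Hilb (m + k) :=
  LinearMap.mk₂ ℂ tensorVec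
    (fun f f' g => by
      refine Lp.ext ?_
      filter_upwards [coeFn_tensorVec (f + f') g, coeFn_tensorVec f g, coeFn_tensorVec f' g,
        Lp.coeFn_add (tensorVec f g) (tensorVec f' g),
        (quasi_left m k).ae (Lp.coeFn_add f f')] with x h1 h2 h3 h4 h5
      simp only [h1, h4, h5, Pi.add_apply, h2, h3, add_mul])
    (fun c f g => by
      refine Lp.ext ?_
      filter_upwards [coeFn_tensorVec (c • f) g, coeFn_tensorVec f g,
        Lp.coeFn_smul c (tensorVec f g), (quasi_left m k).ae (Lp.coeFn_smul c f)] with x h1 h2 h4 h5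
      simp only [h1, h4, h5, Pi.smul_apply, h2, smul_eq_mul, mul_assoc])
    (fun f g g' => by
      refine Lp.ext ?_
      filter_upwards [coeFn_tensorVec f (g + g'), coeFn_tensorVec f g, coeFn_tensorVec f g',
        Lp.coeFn_add (tensorVec f g) (tensorVec f g'),
        (quasi_right m k).ae (Lp.coeFn_add g g')] with x h1 h2 h3 h4 h5
      simp only [h1, h4, h5, Pi.add_apply, h2, h3, mul_add])
    (fun c f g => by
      refine Lp.ext ?_
      filter_upwards [coeFn_tensorVec f (c • g), coeFn_tensorVec f g,
        Lp.coeFn_smul c (tensorVec f g),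
        (quasi_right m k).ae (Lp.coeFn_smul c g)] with x h1 h2 h4 h5
      simp only [h1, h4, h5, Pi.smul_apply, h2, smul_eq_mul]
      ring)

theorem inner_tensorVec {m k : ℕ} (f f' : Hilb m) (g g' : Hilb k) :
    ⟪tensorVec f g, tensorVec f' g'⟫_ℂ = ⟪f, f'⟫_ℂ * ⟪g, g'⟫_ℂ := by
  let F : (Fin m → ℝ) × (Fin k → ℝ) → ℂ := fun p => ⟪f p.1, f' p.1⟫_ℂ * ⟪g p.2, g' p.2⟫_ℂ
  have hm : AEStronglyMeasurable F volume :=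
    (AEStronglyMeasurable.inner (𝕜 := ℂ) (Lp.aestronglyMeasurable f)
      (Lp.aestronglyMeasurable f')).comp_fst.mul
    (AEStronglyMeasurable.inner (𝕜 := ℂ) (Lp.aestronglyMeasurable g)
      (Lp.aestronglyMeasurable g')).comp_snd
  have h : ∫ x : Fin (m + k) → ℝ, ⟪tensorVec f g x, tensorVec f' g' x⟫_ℂ =
      ∫ x : Fin (m + k) → ℝ, F (left x, right x) := by
    refine integral_congr_ae ?_
    filter_upwards [coeFn_tensorVec f g, coeFn_tensorVec f' g'] with x h1 h2
    simp only [F, h1, h2, RCLike.inner_apply, map_mul]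
    ring
  have h' : ∫ p, F p = ∫ x : Fin (m + k) → ℝ, F (left x, right x) := by
    have e := (measurePreserving_split m k).map_eq
    have := integral_map (measurePreserving_split m k).measurable.aemeasurable (f := F)
      (by rwa [e])
    rwa [e] at this
  rw [L2.inner_def, L2.inner_def, L2.inner_def, h, ← h', Measure.volume_eq_prod]
  exact integral_prod_mul (fun x => ⟪f x, f' x⟫_ℂ) (fun y => ⟪g y, g' y⟫_ℂ)

/-- The canonical map of the algebraic tensor product `L²(ℝᵐ) ⊗ L²(ℝᵏ)` into `L²(ℝᵐ⁺ᵏ)`. -/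
def tensorMap (m k : ℕ) : Hilb m ⊗[ℂ] Hilb k →ₗ[ℂ] Hilb (m + k) :=
  TensorProduct.lift (tensorBilin m k)

theorem tensorMap_tmul {m k : ℕ} (f : Hilb m) (g : Hilb k) :
    tensorMap m k (f ⊗ₜ g) = tensorVec f g := rfl

theorem inner_tensorMap {m k : ℕ} (u v : Hilb m ⊗[ℂ] Hilb k) :
    ⟪tensorMap m k u, tensorMap m k v⟫_ℂ = ⟪u, v⟫_ℂ := by
  induction u using TensorProduct.induction_on with
  | zero => simp
  | add u u' hu hu' => rw [map_add, inner_add_left, inner_add_left, hu, hu']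
  | tmul f g =>
    induction v using TensorProduct.induction_on with
    | zero => simp
    | add v v' hv hv' => rw [map_add, inner_add_right, inner_add_right, hv, hv']
    | tmul f' g' =>
      rw [tensorMap_tmul, tensorMap_tmul, inner_tensorVec, TensorProduct.inner_tmul]

theorem norm_tensorMap {m k : ℕ} (u : Hilb m ⊗[ℂ] Hilb k) : ‖tensorMap m k u‖ = ‖u‖ := by
  rw [@norm_eq_sqrt_re_inner ℂ, @norm_eq_sqrt_re_inner ℂ, inner_tensorMap]

theorem exists_bound_map {m k : ℕ} (A : Hilb m →L[ℂ] Hilb m) (B : Hilb k →L[ℂ] Hilb k) :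
    ∃ C : ℝ, ∀ u : Hilb m ⊗[ℂ] Hilb k,
      ‖TensorProduct.map (A : Hilb m →ₗ[ℂ] Hilb m) (B : Hilb k →ₗ[ℂ] Hilb k) u‖ ≤ C * ‖u‖ := by
  have hA : A ∈ Submodule.span ℂ (unitary (Hilb m →L[ℂ] Hilb m) : Set _) := by
    rw [CStarAlgebra.span_unitary]; trivial
  have hB : B ∈ Submodule.span ℂ (unitary (Hilb k →L[ℂ] Hilb k) : Set _) := by
    rw [CStarAlgebra.span_unitary]; trivial
  induction hA using Submodule.span_induction with
  | zero => exact ⟨0, fun u => by simp [TensorProduct.map_zero_left]⟩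
  | add A A' _ _ h h' =>
    obtain ⟨C, h⟩ := h
    obtain ⟨C', h'⟩ := h'
    refine ⟨C + C', fun u => ?_⟩
    rw [ContinuousLinearMap.toLinearMap_add, TensorProduct.map_add_left, LinearMap.add_apply,
      add_mul]
    exact (norm_add_le _ _).trans (add_le_add (h u) (h' u))
  | smul c A _ h =>
    obtain ⟨C, h⟩ := h
    refine ⟨‖c‖ * C, fun u => ?_⟩
    rw [ContinuousLinearMap.toLinearMap_smul, TensorProduct.map_smul_left, LinearMap.smul_apply,
      norm_smul, mul_assoc]
    exact mul_le_mul_of_nonneg_left (h u) (norm_nonneg c)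
  | mem A hA =>
    induction hB using Submodule.span_induction with
    | zero => exact ⟨0, fun u => by simp [TensorProduct.map_zero_right]⟩
    | add A A' _ _ h h' =>
      obtain ⟨C, h⟩ := h
      obtain ⟨C', h'⟩ := h'
      refine ⟨C + C', fun u => ?_⟩
      rw [ContinuousLinearMap.toLinearMap_add, TensorProduct.map_add_right, LinearMap.add_apply,
        add_mul]
      exact (norm_add_le _ _).trans (add_le_add (h u) (h' u))
    | smul c A _ h =>
      obtain ⟨C, h⟩ := h
      refine ⟨‖c‖ * C, fun u => ?_⟩
      rw [ContinuousLinearMap.toLinearMap_smul, TensorProduct.map_smul_right, LinearMap.smul_apply,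
        norm_smul, mul_assoc]
      exact mul_le_mul_of_nonneg_left (h u) (norm_nonneg c)
    | mem B hB =>
      refine ⟨1, fun u => ?_⟩
      rw [one_mul]
      exact (TensorProduct.norm_map (Unitary.linearIsometryEquiv ⟨A, hA⟩).toLinearIsometry
        (Unitary.linearIsometryEquiv ⟨B, hB⟩).toLinearIsometry u).le

theorem mem_closedBall_split {m k : ℕ} (x y : Fin (m + k) → ℝ) {r : ℝ} (hr : 0 ≤ r) :
    y ∈ Metric.closedBall x r ↔
      left y ∈ Metric.closedBall (left x) r ∧ right y ∈ Metric.closedBall (right x) r := by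
  simp only [Metric.mem_closedBall, dist_pi_le_iff hr]
  exact ⟨fun h => ⟨fun i => h _, fun i => h _⟩,
    fun h i => Fin.addCases (fun i => h.1 i) (fun i => h.2 i) i⟩

theorem setIntegral_closedBall_eq_zero {m k : ℕ} {h : Hilb (m + k)}
    (hh : ∀ f g, ⟪tensorVec f g, h⟫_ℂ = 0) (x : Fin (m + k) → ℝ) {r : ℝ} (hr : 0 ≤ r) :
    ∫ y in Metric.closedBall x r, h y = 0 := by
  have hm : MeasurableSet (Metric.closedBall (left x : Fin m → ℝ) r) :=
    Metric.isClosed_closedBall.measurableSet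
  have hk : MeasurableSet (Metric.closedBall (right x : Fin k → ℝ) r) :=
    Metric.isClosed_closedBall.measurableSet
  have hmv : volume (Metric.closedBall (left x : Fin m → ℝ) r) ≠ ⊤ :=
    measure_closedBall_lt_top.ne
  have hkv : volume (Metric.closedBall (right x : Fin k → ℝ) r) ≠ ⊤ :=
    measure_closedBall_lt_top.ne
  have h0 := hh (indicatorConstLp 2 hm hmv 1) (indicatorConstLp 2 hk hkv 1)
  rw [L2.inner_def] at h0
  rw [← integral_indicator Metric.isClosed_closedBall.measurableSet, ← h0]
  refine integral_congr_ae ?_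
  filter_upwards [coeFn_tensorVec (indicatorConstLp 2 hm hmv (1 : ℂ))
      (indicatorConstLp 2 hk hkv (1 : ℂ)),
    (quasi_left m k).ae (indicatorConstLp_coeFn (p := 2) (hs := hm) (hμs := hmv) (c := (1 : ℂ))),
    (quasi_right m k).ae (indicatorConstLp_coeFn (p := 2) (hs := hk) (hμs := hkv) (c := (1 : ℂ)))]
    with y h1 h2 h3
  rw [h1, h2, h3, RCLike.inner_apply]
  by_cases hy : y ∈ Metric.closedBall x r
  · have hy' := (mem_closedBall_split x y hr).1 hy
    simp [Set.indicator_of_mem, hy, hy'.1, hy'.2]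
  · rw [Set.indicator_of_notMem hy]
    rw [mem_closedBall_split x y hr, not_and_or] at hy
    rcases hy with hy | hy <;> simp [Set.indicator_of_notMem hy]

theorem denseRange_tensorMap (m k : ℕ) : DenseRange (tensorMap m k) := by
  have key : (LinearMap.range (tensorMap m k)).topologicalClosure = ⊤ := by
    rw [Submodule.topologicalClosure_eq_top_iff, Submodule.eq_bot_iff]
    intro h hh
    have hh' : ∀ f g, ⟪tensorVec f g, h⟫_ℂ = 0 := fun f g =>
      (Submodule.mem_orthogonal _ _).1 hh _ ⟨f ⊗ₜ g, rfl⟩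
    have hl : LocallyIntegrable (h : (Fin (m + k) → ℝ) → ℂ) volume :=
      (Lp.memLp h).locallyIntegrable one_le_two
    refine (Lp.eq_zero_iff_ae_eq_zero).2 ?_
    filter_upwards [IsUnifLocDoublingMeasure.ae_tendsto_average volume hl 1] with x hx
    have hδ : Tendsto (fun j : ℕ => 1 / ((j : ℝ) + 1)) atTop (𝓝[>] 0) :=
      tendsto_nhdsWithin_iff.2 ⟨tendsto_one_div_add_atTop_nhds_zero_nat,
        Eventually.of_forall fun j => Set.mem_Ioi.2 (by positivity)⟩
    have ht := hx (fun _ : ℕ => x) _ hδ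
      (Eventually.of_forall fun j => Metric.mem_closedBall_self (by positivity))
    have h0 : ∀ j : ℕ, ⨍ y in Metric.closedBall x (1 / ((j : ℝ) + 1)), h y = 0 := fun j => by
      rw [setAverage_eq, setIntegral_closedBall_eq_zero hh' x (by positivity), smul_zero]
    simp only [h0] at ht
    exact (tendsto_nhds_unique ht tendsto_const_nhds)
  intro v
  have : v ∈ (LinearMap.range (tensorMap m k)).topologicalClosure := key ▸ Submodule.mem_top
  exact this

/-- The tensor product `A ⊗ B` of bounded operators on `L²(ℝᵐ)` and `L²(ℝᵏ)`, as an operator on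
`L²(ℝᵐ⁺ᵏ)`: the bounded extension of the algebraic tensor product along the dense isometric
inclusion `L²(ℝᵐ) ⊗ L²(ℝᵏ) → L²(ℝᵐ⁺ᵏ)`. -/
def tensorOp {m k : ℕ} (A : Hilb m →L[ℂ] Hilb m) (B : Hilb k →L[ℂ] Hilb k) :
    Hilb (m + k) →L[ℂ] Hilb (m + k) :=
  (tensorMap m k ∘ₗ TensorProduct.map (A : Hilb m →ₗ[ℂ] Hilb m)
    (B : Hilb k →ₗ[ℂ] Hilb k)).extendOfNorm (tensorMap m k)

/-- `A ⊗ B` is the operator with `(A ⊗ B)(f ⊗ g) = A f ⊗ B g`. -/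
theorem tensorOp_tensorVec {m k : ℕ} (A : Hilb m →L[ℂ] Hilb m) (B : Hilb k →L[ℂ] Hilb k)
    (f : Hilb m) (g : Hilb k) :
    tensorOp A B (tensorVec f g) = tensorVec (A f) (B g) := by
  obtain ⟨C, hC⟩ := exists_bound_map A B
  refine LinearMap.extendOfNorm_eq (denseRange_tensorMap m k) ⟨C, fun u => ?_⟩ (f ⊗ₜ g)
  rw [LinearMap.comp_apply, norm_tensorMap, norm_tensorMap]
  exact hC u

/-! ### States, traces and the Zak-Gross Wigner function -/

/-- The index set of a fixed Hilbert basis of `L²(ℝⁿ)`. -/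
def basisIndex (n : ℕ) : Set (Hilb n) := (exists_hilbertBasis ℂ (Hilb n)).choose

/-- A fixed Hilbert basis of `L²(ℝⁿ)`. -/
def basis (n : ℕ) : HilbertBasis (basisIndex n) ℂ (Hilb n) :=
  (exists_hilbertBasis ℂ (Hilb n)).choose_spec.choose

/-- The trace `∑ᵢ ⟨eᵢ, C eᵢ⟩` of a trace-class operator `C` (it does not depend on the Hilbert basis
`(eᵢ)`). -/
def trace {n : ℕ} (C : Hilb n →L[ℂ] Hilb n) : ℂ := ∑' i, ⟪basis n i, C (basis n i)⟫_ℂ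

/-- States (density operators): positive operators of trace one. -/
def IsState {n : ℕ} (ρ : Hilb n →L[ℂ] Hilb n) : Prop :=
  ρ.IsPositive ∧
    ∀ (s : Set (Hilb n)) (e : HilbertBasis s ℂ (Hilb n)), HasSum (fun i => ⟪e i, ρ (e i)⟫_ℂ) 1

/-- The series `Tr(ρ A_η) = (2π)⁻ⁿ ∑_a exp(iℓ[a, η] + iπ a_X · a_Z) Tr(ρ T_a)` converges absolutely
(its coefficients have modulus one, so this does not depend on `η`). -/
def HasConvergentWigner {n : ℕ} (d : ℕ) (ρ : Hilb n →L[ℂ] Hilb n) : Prop :=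
  Summable fun a : Phase ℤ n => trace (ρ ∘L T d (toReal a))

/-- `W` is an integrable function on `[0, dℓ)^{2n}` whose Fourier series is the series
`Tr(ρ A_η) = (2π)⁻ⁿ ∑_a exp(iℓ[a, η] + iπ a_X · a_Z) Tr(ρ T_a)`. -/
def HasWignerSeries {n : ℕ} (d : ℕ) (ρ : Hilb n →L[ℂ] Hilb n) (W : Phase ℝ n → ℂ) : Prop :=
  IntegrableOn W (cell d n) ∧
    ∀ a : Phase ℤ n,
      ∫ η in cell d n, Complex.exp (-(Complex.I * ((ell d * symp (toReal a) η : ℝ) : ℂ))) * W η =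
        ((d * ell d : ℝ) : ℂ) ^ (2 * n) * (1 / (2 * (Real.pi : ℂ)) ^ n *
          (Complex.exp (Complex.I * ((Real.pi * ((toReal a).1 ⬝ᵥ (toReal a).2) : ℝ) : ℂ)) *
            trace (ρ ∘L T d (toReal a))))

open Classical in
/-- The Zak-Gross Wigner function `W_ρ(η) = Tr(ρ A_η)`.
If the series `Tr(ρ A_η) = (2π)⁻ⁿ ∑_a exp(iℓ[a, η] + iπ a_X · a_Z) Tr(ρ T_a)` converges absolutely,
then `W_ρ(η)` is its sum, for every `η`. For a general state the series need not converge
pointwise; then it is the Fourier series of an integrable function on `[0, dℓ)^{2n}`, unique up to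
null sets, and `W_ρ` is that function. (The last branch is only there to make the function total: every trace-class
operator has such an integrable function, a sum of products of Zak transforms.) -/
def wigner {n : ℕ} (d : ℕ) (ρ : Hilb n →L[ℂ] Hilb n) : Phase ℝ n → ℂ :=
  if HasConvergentWigner d ρ then fun η =>
    1 / (2 * (Real.pi : ℂ)) ^ n *
      ∑' a : Phase ℤ n, phaseCoeff d η a * trace (ρ ∘L T d (toReal a))
  else if h : ∃ W, HasWignerSeries d ρ W then h.choose
  else 0

/-- The negativity (negative volume) `M_ρ = ∫ |W_ρ(η)| dη` over `[0, dℓ)^{2n}`. -/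
def negativity {n : ℕ} (d : ℕ) (ρ : Hilb n →L[ℂ] Hilb n) : ℝ :=
  ∫ η in cell d n, ‖wigner d ρ η‖

end ZakGross

end

/-!
Under a splitting of the modes the displacement operators factorise, `T_a = T_{a⁽¹⁾} ⊗ T_{a⁽²⁾}`,
and so do the phases in front of them and, since a state is a mixture of vectors, the traces
`Tr((ρ ⊗ σ) T_a)`. Every series over the lattice that converges absolutely is therefore a product of
two series.

For a general state the Wigner function is only given by its Fourier coefficients on the cell, and
the point is that an integrable function with these coefficients exists. For a vector `f`, multiply
the conjugate of its Zak transform over `dℤⁿ` by its Zak transform over `ℤⁿ`: both are square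
integrable, so the product is integrable, and its coefficients are, up to a constant, the numbers
`exp(iπ a_X · a_Z / d) ⟨f, T_a f⟩`. The missing phase `exp(iπ (d - 1) a_X · a_Z / d)` depends on `a`
modulo `2d` only, so it is a linear combination of characters of the lattice, and replacing `f` by a
displaced vector multiplies the numbers `⟨f, T_a f⟩` by a character. Mixtures of vectors are handled
by absolute convergence in `L¹`.

Integrable functions with the same Fourier coefficients agree almost everywhere. This gives the
product formula for Wigner functions, and Fubini's theorem turns it into that for negativities.
-/

noncomputable section

namespace ZakGross

/-! ### Displacement operators -/

section Displacement

variable {n : ℕ}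

theorem exp_I_mul_ofReal (r : ℝ) : Complex.exp (Complex.I * r) = Circle.exp r := by
  rw [Circle.coe_exp, mul_comm]

theorem coeFn_translation (s : Fin n → ℝ) (f : Hilb n) :
    translation s f =ᵐ[volume] fun x => f (x - s) :=
  Lp.coeFn_compMeasurePreserving f (measurePreserving_sub_right volume s)

theorem coeFn_modulation (t : Fin n → ℝ) (f : Hilb n) :
    modulation t f =ᵐ[volume] fun x => Circle.exp (t ⬝ᵥ x) * f x := by
  simp only [← exp_I_mul_ofReal]
  exact (memLp_modulation t f).coeFn_toLp

theorem T_apply (d : ℕ) (a : Phase ℝ n) (f : Hilb n) :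
    T d a f = (Circle.exp (Real.pi * (a.1 ⬝ᵥ a.2) / d) : ℂ) •
      translation (ell d • a.1) (modulation (ell d • a.2) f) := by
  rw [← exp_I_mul_ofReal]
  rfl

theorem coeFn_T (d : ℕ) (a : Phase ℝ n) (f : Hilb n) :
    T d a f =ᵐ[volume] fun x =>
      Circle.exp (Real.pi * (a.1 ⬝ᵥ a.2) / d + (ell d • a.2) ⬝ᵥ (x - ell d • a.1)) *
        f (x - ell d • a.1) := by
  rw [T_apply]
  filter_upwards [Lp.coeFn_smul (Circle.exp (Real.pi * (a.1 ⬝ᵥ a.2) / d) : ℂ)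
      (translation (ell d • a.1) (modulation (ell d • a.2) f)),
    coeFn_translation (ell d • a.1) (modulation (ell d • a.2) f),
    (measurePreserving_sub_right volume (ell d • a.1)).quasiMeasurePreserving.ae
      (coeFn_modulation (ell d • a.2) f)] with x h_smul h_trans h_mod
  rw [h_smul, Pi.smul_apply, h_trans, h_mod, smul_eq_mul, Circle.exp_add, Circle.coe_mul, mul_assoc]

end Displacement

/-! ### Decomposition into two groups of modes -/

section Modes

variable {m k : ℕ}

theorem dotProduct_eq_left_add_right {R : Type} [NonUnitalNonAssocSemiring R]
    (x y : Fin (m + k) → R) : x ⬝ᵥ y = left x ⬝ᵥ left y + right x ⬝ᵥ right y :=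
  Fin.sum_univ_add _

theorem symp_eq_fstModes_add_sndModes (a b : Phase ℝ (m + k)) :
    symp a b = symp (fstModes a) (fstModes b) + symp (sndModes a) (sndModes b) := by
  simp only [symp, dotProduct_eq_left_add_right a.1 b.2, dotProduct_eq_left_add_right a.2 b.1,
    fstModes, sndModes]
  ring

/-- The decomposition `a ↦ (a⁽¹⁾, a⁽²⁾)` of a phase-space vector, as an equivalence. -/
def modesEquiv (R : Type) (m k : ℕ) : Phase R (m + k) ≃ Phase R m × Phase R k where
  toFun a := (fstModes a, sndModes a)
  invFun p := (Fin.append p.1.1 p.2.1, Fin.append p.1.2 p.2.2)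
  left_inv a := by
    refine Prod.ext (funext fun i => ?_) (funext fun i => ?_) <;>
      refine Fin.addCases (fun i => ?_) (fun i => ?_) i <;> simp [fstModes, sndModes, left, right]
  right_inv p := by
    refine Prod.ext (Prod.ext ?_ ?_) (Prod.ext ?_ ?_) <;> funext i <;>
      simp [fstModes, sndModes, left, right]

theorem modesEquiv_apply {R : Type} (a : Phase R (m + k)) :
    modesEquiv R m k a = (fstModes a, sndModes a) := rfl

theorem T_tensorVec (d : ℕ) (a : Phase ℝ (m + k)) (f : Hilb m) (g : Hilb k) :
    T d a (tensorVec f g) = tensorVec (T d (fstModes a) f) (T d (sndModes a) g) := by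
  have phase_add (x : Fin (m + k) → ℝ) :
      Real.pi * (a.1 ⬝ᵥ a.2) / d + (ell d • a.2) ⬝ᵥ (x - ell d • a.1) =
        Real.pi * (left a.1 ⬝ᵥ left a.2) / d
            + (ell d • left a.2) ⬝ᵥ (left x - ell d • left a.1) +
          (Real.pi * (right a.1 ⬝ᵥ right a.2) / d
            + (ell d • right a.2) ⬝ᵥ (right x - ell d • right a.1)) := by
    rw [dotProduct_eq_left_add_right a.1, dotProduct_eq_left_add_right (ell d • a.2), mul_add,
      add_div, add_add_add_comm]
    rfl
  refine Lp.ext ?_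
  filter_upwards [coeFn_T d a (tensorVec f g),
    (measurePreserving_sub_right volume (ell d • a.1)).quasiMeasurePreserving.ae
      (coeFn_tensorVec f g),
    coeFn_tensorVec (T d (fstModes a) f) (T d (sndModes a) g),
    (quasi_left m k).ae (coeFn_T d (fstModes a) f),
    (quasi_right m k).ae (coeFn_T d (sndModes a) g)] with x h_T h_shift h_tensor h_left h_right
  rw [h_T, h_shift, h_tensor, h_left, h_right, phase_add, Circle.exp_add, Circle.coe_mul]
  exact mul_mul_mul_comm _ _ _ _

theorem clm_ext_tensorVec {E : Type*} [AddCommGroup E] [Module ℂ E] [TopologicalSpace E]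
    [T2Space E] {A B : Hilb (m + k) →L[ℂ] E} (h : ∀ f g, A (tensorVec f g) = B (tensorVec f g)) :
    A = B := by
  have h_comp : (A : Hilb (m + k) →ₗ[ℂ] E) ∘ₗ tensorMap m k =
      (B : Hilb (m + k) →ₗ[ℂ] E) ∘ₗ tensorMap m k := TensorProduct.ext' fun f g => h f g
  exact ContinuousLinearMap.coeFn_injective
    ((denseRange_tensorMap m k).equalizer A.continuous B.continuous (congrArg DFunLike.coe h_comp))

theorem tensorVec_eq_tensorBilin (f : Hilb m) (g : Hilb k) :
    tensorVec f g = tensorBilin m k f g := rfl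

theorem tensorOp_T (d : ℕ) (a : Phase ℝ (m + k)) :
    tensorOp (T d (fstModes a)) (T d (sndModes a)) = T d a :=
  clm_ext_tensorVec fun f g => by rw [tensorOp_tensorVec, T_tensorVec]

theorem tensorOp_smul_smul (c c' : ℂ) (A : Hilb m →L[ℂ] Hilb m) (B : Hilb k →L[ℂ] Hilb k) :
    tensorOp (c • A) (c' • B) = (c * c') • tensorOp A B := by
  refine clm_ext_tensorVec fun f g => ?_
  rw [smul_apply, tensorOp_tensorVec, tensorOp_tensorVec]
  simp only [smul_apply, tensorVec_eq_tensorBilin, map_smul, LinearMap.smul_apply, smul_smul]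
  rw [mul_comm]

theorem tensorOp_sum_sum {ι κ : Type*} (S : Finset ι) (S' : Finset κ)
    (A : ι → Hilb m →L[ℂ] Hilb m) (B : κ → Hilb k →L[ℂ] Hilb k) :
    tensorOp (∑ i ∈ S, A i) (∑ j ∈ S', B j) = ∑ p ∈ S ×ˢ S', tensorOp (A p.1) (B p.2) := by
  refine clm_ext_tensorVec fun f g => ?_
  simp only [tensorOp_tensorVec, sum_apply]
  simp only [tensorVec_eq_tensorBilin, map_sum, LinearMap.sum_apply, Finset.sum_product]
  exact Finset.sum_comm

end Modes

/-! ### Fourier series over the phase-space lattice -/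

section LatticeSeries

variable {n m k : ℕ}

/-- The character `η ↦ exp(iℓ[a, η])` of phase space, for `a ∈ ℤ²ⁿ`. It is periodic with respect to
the lattice `(dℓℤ)²ⁿ`, which has `cell d n` as a fundamental domain. -/
def latticeChar (d : ℕ) (a : Phase ℤ n) (η : Phase ℝ n) : Circle :=
  Circle.exp (ell d * symp (toReal a) η)

/-- The sum `∑ₐ cₐ exp(iℓ[a, η])` of a Fourier series. -/
def fourierSum (d : ℕ) (c : Phase ℤ n → ℂ) (η : Phase ℝ n) : ℂ :=
  ∑' a, latticeChar d a η * c a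

/-- The sign `exp(iπ a_X · a_Z) = (-1)^(a_X · a_Z)` of a lattice vector. -/
def latticeSign (a : Phase ℤ n) : Circle :=
  Circle.exp (Real.pi * ((toReal a).1 ⬝ᵥ (toReal a).2))

/-- The coefficients `(2π)⁻ⁿ exp(iπ a_X · a_Z) tₐ` of the Fourier series attached to the phase-point
operators, if `tₐ` is the value of `T_a` under a linear functional (a matrix element or a trace). -/
def phasePointCoeff (t : Phase ℤ n → ℂ) (a : Phase ℤ n) : ℂ :=
  1 / (2 * (Real.pi : ℂ)) ^ n * (latticeSign a * t a)

theorem summable_circle_mul {ι : Type*} (z : ι → Circle) {c : ι → ℂ} (hc : Summable c) :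
    Summable fun i => z i * c i :=
  Summable.of_norm (by simpa only [norm_mul, Circle.norm_coe, one_mul] using hc.norm)

theorem summable_phasePointCoeff {t : Phase ℤ n → ℂ} (ht : Summable t) :
    Summable (phasePointCoeff t) :=
  (summable_circle_mul latticeSign ht).mul_left _

theorem phaseCoeff_eq_mul (d : ℕ) (η : Phase ℝ n) (a : Phase ℤ n) :
    phaseCoeff d η a = latticeChar d a η * latticeSign a := by
  rw [phaseCoeff, exp_I_mul_ofReal, Circle.exp_add, Circle.coe_mul, latticeChar, latticeSign]

theorem const_mul_tsum_phaseCoeff_mul (d : ℕ) (η : Phase ℝ n) (t : Phase ℤ n → ℂ) :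
    1 / (2 * (Real.pi : ℂ)) ^ n * ∑' a, phaseCoeff d η a * t a =
      fourierSum d (phasePointCoeff t) η := by
  rw [fourierSum, ← tsum_mul_left]
  refine tsum_congr fun a => ?_
  rw [phaseCoeff_eq_mul, phasePointCoeff]
  ring

theorem latticeChar_eq_mul_modes (d : ℕ) (a : Phase ℤ (m + k)) (η : Phase ℝ (m + k)) :
    latticeChar d a η =
      latticeChar d (fstModes a) (fstModes η) * latticeChar d (sndModes a) (sndModes η) := by
  rw [latticeChar, symp_eq_fstModes_add_sndModes, mul_add, Circle.exp_add]
  rfl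

theorem latticeSign_eq_mul_modes (a : Phase ℤ (m + k)) :
    latticeSign a = latticeSign (fstModes a) * latticeSign (sndModes a) := by
  rw [latticeSign, dotProduct_eq_left_add_right, mul_add, Circle.exp_add]
  rfl

theorem phaseCoeff_eq_mul_modes (d : ℕ) (η : Phase ℝ (m + k)) (a : Phase ℤ (m + k)) :
    phaseCoeff d η a =
      phaseCoeff d (fstModes η) (fstModes a) * phaseCoeff d (sndModes η) (sndModes a) := by
  simp only [phaseCoeff_eq_mul, latticeChar_eq_mul_modes, latticeSign_eq_mul_modes, Circle.coe_mul]
  exact mul_mul_mul_comm _ _ _ _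

theorem phasePointCoeff_modes (u : Phase ℤ m → ℂ) (v : Phase ℤ k → ℂ) (a : Phase ℤ (m + k)) :
    phasePointCoeff (fun a => u (fstModes a) * v (sndModes a)) a =
      phasePointCoeff u (fstModes a) * phasePointCoeff v (sndModes a) := by
  rw [phasePointCoeff, phasePointCoeff, phasePointCoeff, latticeSign_eq_mul_modes,
    Circle.coe_mul, pow_add, ← one_div_mul_one_div]
  ring

theorem summable_mul_modes {u : Phase ℤ m → ℂ} {v : Phase ℤ k → ℂ} (hu : Summable u)
    (hv : Summable v) : Summable fun a : Phase ℤ (m + k) => u (fstModes a) * v (sndModes a) :=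
  (modesEquiv ℤ m k).summable_iff.2 (summable_mul_of_summable_norm hu.norm hv.norm)

theorem fourierSum_mul_modes (d : ℕ) {u : Phase ℤ m → ℂ} {v : Phase ℤ k → ℂ} (hu : Summable u)
    (hv : Summable v) (η : Phase ℝ (m + k)) :
    fourierSum d (fun a => u (fstModes a) * v (sndModes a)) η =
      fourierSum d u (fstModes η) * fourierSum d v (sndModes η) := by
  rw [fourierSum, fourierSum, fourierSum, tsum_mul_tsum_of_summable_norm
    (summable_circle_mul _ hu).norm (summable_circle_mul _ hv).norm,
    ← (modesEquiv ℤ m k).tsum_eq]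
  refine tsum_congr fun a => ?_
  rw [latticeChar_eq_mul_modes, Circle.coe_mul, modesEquiv_apply]
  exact mul_mul_mul_comm _ _ _ _

theorem fourierSum_phasePointCoeff_mul_modes (d : ℕ) {u : Phase ℤ m → ℂ} {v : Phase ℤ k → ℂ}
    (hu : Summable u) (hv : Summable v) (η : Phase ℝ (m + k)) :
    fourierSum d (phasePointCoeff fun a => u (fstModes a) * v (sndModes a)) η =
      fourierSum d (phasePointCoeff u) (fstModes η) *
        fourierSum d (phasePointCoeff v) (sndModes η) := by
  rw [← fourierSum_mul_modes d (summable_phasePointCoeff hu) (summable_phasePointCoeff hv)]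
  exact congrArg (fourierSum d · η) (funext (phasePointCoeff_modes u v))

end LatticeSeries

/-! ### Factorisation of the phase-point operators -/

section PhasePoint

variable {n m k d : ℕ}

theorem phasePoint_eq_fourierSum (η : Phase ℝ n) (f g : Hilb n) :
    phasePoint d η f g = fourierSum d (phasePointCoeff fun a => ⟪f, T d (toReal a) g⟫_ℂ) η :=
  const_mul_tsum_phaseCoeff_mul d η _

theorem inner_phasePointTrunc (η : Phase ℝ n) (S : Finset (Phase ℤ n)) (f g : Hilb n) :
    ⟪f, phasePointTrunc d η S g⟫_ℂ =
      ∑ a ∈ S, latticeChar d a η * phasePointCoeff (fun a => ⟪f, T d (toReal a) g⟫_ℂ) a := by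
  simp only [phasePointTrunc, smul_apply, sum_apply, inner_smul_right, inner_sum, Finset.mul_sum,
    phaseCoeff_eq_mul, phasePointCoeff]
  refine Finset.sum_congr rfl fun a _ => ?_
  ring

theorem tensorOp_phasePointTrunc (η : Phase ℝ (m + k)) (S₁ : Finset (Phase ℤ m))
    (S₂ : Finset (Phase ℤ k)) :
    tensorOp (phasePointTrunc d (fstModes η) S₁) (phasePointTrunc d (sndModes η) S₂) =
      phasePointTrunc d η ((S₁ ×ˢ S₂).map (modesEquiv ℤ m k).symm.toEmbedding) := by
  rw [phasePointTrunc, phasePointTrunc, phasePointTrunc, tensorOp_smul_smul, tensorOp_sum_sum,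
    Finset.sum_map, pow_add, one_div_mul_one_div]
  congr 1
  refine Finset.sum_congr rfl fun p _ => ?_
  obtain ⟨a, rfl⟩ := (modesEquiv ℤ m k).surjective p
  rw [tensorOp_smul_smul, Equiv.coe_toEmbedding, Equiv.symm_apply_apply, phaseCoeff_eq_mul_modes,
    ← tensorOp_T d (toReal a)]
  rfl

theorem inner_tensorVec_T (a : Phase ℤ (m + k)) (f₁ g₁ : Hilb m) (f₂ g₂ : Hilb k) :
    ⟪tensorVec f₁ f₂, T d (toReal a) (tensorVec g₁ g₂)⟫_ℂ =
      ⟪f₁, T d (toReal (fstModes a)) g₁⟫_ℂ * ⟪f₂, T d (toReal (sndModes a)) g₂⟫_ℂ := by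
  rw [T_tensorVec, inner_tensorVec]
  rfl

theorem inFormDomain_tensorVec {f₁ g₁ : Hilb m} {f₂ g₂ : Hilb k} (h₁ : InFormDomain d f₁ g₁)
    (h₂ : InFormDomain d f₂ g₂) : InFormDomain d (tensorVec f₁ f₂) (tensorVec g₁ g₂) := by
  simpa only [InFormDomain, inner_tensorVec_T] using
    summable_mul_modes (u := fun a => ⟪f₁, T d (toReal a) g₁⟫_ℂ) h₁ h₂

theorem phasePoint_tensorVec {f₁ g₁ : Hilb m} {f₂ g₂ : Hilb k} (h₁ : InFormDomain d f₁ g₁)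
    (h₂ : InFormDomain d f₂ g₂) (η : Phase ℝ (m + k)) :
    phasePoint d η (tensorVec f₁ f₂) (tensorVec g₁ g₂) =
      phasePoint d (fstModes η) f₁ g₁ * phasePoint d (sndModes η) f₂ g₂ := by
  simp only [phasePoint_eq_fourierSum, inner_tensorVec_T]
  exact fourierSum_phasePointCoeff_mul_modes d (u := fun a => ⟪f₁, T d (toReal a) g₁⟫_ℂ)
    (v := fun a => ⟪f₂, T d (toReal a) g₂⟫_ℂ) h₁ h₂ η

theorem tendsto_inner_tensorOp_phasePointTrunc {F G : Hilb (m + k)} (h : InFormDomain d F G)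
    (η : Phase ℝ (m + k)) :
    Tendsto (fun S : Finset (Phase ℤ m) × Finset (Phase ℤ k) =>
        ⟪F, tensorOp (phasePointTrunc d (fstModes η) S.1)
          (phasePointTrunc d (sndModes η) S.2) G⟫_ℂ)
      atTop (𝓝 (phasePoint d η F G)) := by
  have h_sum := (modesEquiv ℤ m k).symm.hasSum_iff.2
    (summable_circle_mul (latticeChar d · η) (summable_phasePointCoeff h)).hasSum
  rw [phasePoint_eq_fourierSum]
  refine (Tendsto.comp h_sum tendsto_finsetProd_atTop).congr fun S => ?_
  simp only [tensorOp_phasePointTrunc, inner_phasePointTrunc, Finset.sum_map, Function.comp_apply,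
    Equiv.coe_toEmbedding]

end PhasePoint

/-! ### Matrix elements between Schwartz functions -/

section Ell

variable {d : ℕ}

theorem ell_pos (hd : 0 < d) : 0 < ell d :=
  Real.sqrt_pos.2 (by positivity)

theorem mul_ell_mul_ell (hd : 0 < d) : d * (ell d * ell d) = 2 * Real.pi := by
  rw [ell, Real.mul_self_sqrt (by positivity)]
  field_simp

end Ell

section Summability

theorem summable_prod_apply {α : Type*} {f : α → ℝ} (hf₀ : ∀ a, 0 ≤ f a) (hf : Summable f)
    (n : ℕ) : Summable fun a : Fin n → α => ∏ i, f (a i) := by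
  induction n with
  | zero => exact (hasSum_fintype _).summable
  | succ n ih =>
    refine (Fin.consEquiv fun _ : Fin (n + 1) => α).summable_iff.1 ?_
    refine (hf.mul_of_nonneg ih hf₀ fun a => Finset.prod_nonneg fun i _ => hf₀ _).congr fun p => ?_
    simp [Fin.prod_univ_succ, Fin.consEquiv]

theorem summable_inv_one_add_sq_mul_int {c : ℝ} (hc : 0 < c) :
    Summable fun a : ℤ => (1 + (c * a) ^ 2)⁻¹ := by
  refine Summable.of_norm_bounded_eventually
    (((Real.summable_one_div_int_pow (p := 2)).2 one_lt_two).mul_left (1 / c ^ 2)) ?_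
  filter_upwards [eventually_cofinite_ne (0 : ℤ)] with a ha
  rw [Real.norm_of_nonneg (by positivity), one_div_mul_one_div, ← one_div, ← mul_pow]
  exact one_div_le_one_div_of_le (by positivity) (by linarith)

end Summability

section CrossAmbiguity

variable {n : ℕ}

/-- The cross-ambiguity function `⟨φ, exp(-i s · p̂) exp(i t · q̂) ψ⟩` of two Schwartz functions. -/
def crossAmbiguity (φ ψ : 𝓢(Fin n → ℝ, ℂ)) (s t : Fin n → ℝ) : ℂ :=
  ∫ x, (Circle.exp (t ⬝ᵥ (x - s)) : ℂ) * (starRingEnd ℂ (φ x) * ψ (x - s))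

theorem integrable_conj_mul_translate (φ ψ : 𝓢(Fin n → ℝ, ℂ)) (s : Fin n → ℝ) :
    Integrable fun x => starRingEnd ℂ (φ x) * ψ (x - s) :=
  (Complex.conjLIE.integrable_comp_iff.2 φ.integrable).mul_bdd
    (ψ.continuous.comp (continuous_sub_right s)).aestronglyMeasurable
    (Eventually.of_forall fun x => ψ.norm_le_seminorm ℝ (x - s))

theorem continuous_exp_dotProduct (t : Fin n → ℝ) (s : Fin n → ℝ) :
    Continuous fun x => (Circle.exp (t ⬝ᵥ (x - s)) : ℂ) := by
  unfold dotProduct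
  fun_prop

theorem integrable_crossAmbiguity (φ ψ : 𝓢(Fin n → ℝ, ℂ)) (s t : Fin n → ℝ) :
    Integrable fun x =>
      (Circle.exp (t ⬝ᵥ (x - s)) : ℂ) * (starRingEnd ℂ (φ x) * ψ (x - s)) :=
  (integrable_conj_mul_translate φ ψ s).bdd_mul (c := 1)
    (continuous_exp_dotProduct t s).aestronglyMeasurable
    (Eventually.of_forall fun _ => (Circle.norm_coe _).le)

theorem norm_crossAmbiguity_le (φ ψ : 𝓢(Fin n → ℝ, ℂ)) (s t : Fin n → ℝ) :
    ‖crossAmbiguity φ ψ s t‖ ≤ (∫ x, ‖φ x‖) * SchwartzMap.seminorm ℝ 0 0 ψ := by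
  rw [← integral_mul_const]
  refine norm_integral_le_of_norm_le (φ.integrable.norm.mul_const _)
    (Eventually.of_forall fun x => ?_)
  rw [norm_mul, Circle.norm_coe, one_mul, norm_mul, RCLike.norm_conj]
  exact mul_le_mul_of_nonneg_left (ψ.norm_le_seminorm ℝ _) (norm_nonneg _)

/-- Multiplication of a Schwartz function by the `i`-th coordinate. -/
def mulCoord (i : Fin n) (φ : 𝓢(Fin n → ℝ, ℂ)) : 𝓢(Fin n → ℝ, ℂ) :=
  SchwartzMap.smulLeftCLM ℂ (fun x : Fin n → ℝ => x i) φ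

theorem mulCoord_apply (φ : 𝓢(Fin n → ℝ, ℂ)) (i : Fin n) (x : Fin n → ℝ) :
    mulCoord i φ x = (x i : ℂ) * φ x := by
  have h_growth : Function.HasTemperateGrowth fun x : Fin n → ℝ => x i :=
    (ContinuousLinearMap.proj (R := ℝ) (φ := fun _ : Fin n => ℝ) i).hasTemperateGrowth
  rw [mulCoord, SchwartzMap.smulLeftCLM_apply_apply h_growth, Complex.real_smul]

theorem coord_mul_crossAmbiguity (φ ψ : 𝓢(Fin n → ℝ, ℂ)) (s t : Fin n → ℝ) (i : Fin n) :
    (s i : ℂ) * crossAmbiguity φ ψ s t =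
      crossAmbiguity (mulCoord i φ) ψ s t - crossAmbiguity φ (mulCoord i ψ) s t := by
  rw [crossAmbiguity, crossAmbiguity, crossAmbiguity,
    ← integral_sub (integrable_crossAmbiguity _ _ s t) (integrable_crossAmbiguity _ _ s t),
    ← integral_const_mul]
  congr with x
  simp only [mulCoord_apply, map_mul, Complex.conj_ofReal, Pi.sub_apply, Complex.ofReal_sub]
  ring

theorem hasLineDerivAt_exp_dotProduct (s t v x : Fin n → ℝ) :
    HasLineDerivAt ℝ (fun x => (Circle.exp (t ⬝ᵥ (x - s)) : ℂ))
      ((Circle.exp (t ⬝ᵥ (x - s)) : ℂ) * (Complex.I * (t ⬝ᵥ v : ℝ))) x v := by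
  have h_line (r : ℝ) : t ⬝ᵥ (x + r • v - s) = t ⬝ᵥ (x - s) + r * (t ⬝ᵥ v) := by
    rw [add_sub_right_comm, dotProduct_add, dotProduct_smul, smul_eq_mul]
  have h_affine : HasDerivAt (fun r : ℝ => t ⬝ᵥ (x - s) + r * (t ⬝ᵥ v)) (t ⬝ᵥ v) 0 := by
    simpa using ((hasDerivAt_id (0 : ℝ)).mul_const (t ⬝ᵥ v)).const_add (t ⬝ᵥ (x - s))
  simp only [HasLineDerivAt, h_line, ← exp_I_mul_ofReal]
  simpa using (h_affine.ofReal_comp.const_mul Complex.I).cexp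

open LineDeriv

theorem hasLineDerivAt_conj_mul_translate (φ ψ : 𝓢(Fin n → ℝ, ℂ)) (s v x : Fin n → ℝ) :
    HasLineDerivAt ℝ (fun x => starRingEnd ℂ (φ x) * ψ (x - s))
      (starRingEnd ℂ ((∂_{v} φ) x) * ψ (x - s) + starRingEnd ℂ (φ x) * (∂_{v} ψ) (x - s)) x v := by
  have h_conj : HasFDerivAt (fun x => starRingEnd ℂ (φ x))
      (Complex.conjCLE.toContinuousLinearMap ∘L fderiv ℝ φ x) x :=
    Complex.conjCLE.toContinuousLinearMap.hasFDerivAt.comp x (φ.hasFDerivAt x)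
  have h_translate : HasFDerivAt (fun x => ψ (x - s)) (fderiv ℝ ψ (x - s)) x :=
    (ψ.hasFDerivAt (x - s)).comp x ((hasFDerivAt_id x).sub_const s)
  rw [add_comm, mul_comm _ (ψ (x - s))]
  exact (h_conj.mul h_translate).hasLineDerivAt v

theorem freq_mul_crossAmbiguity (φ ψ : 𝓢(Fin n → ℝ, ℂ)) (s t v : Fin n → ℝ) :
    Complex.I * (t ⬝ᵥ v : ℝ) * crossAmbiguity φ ψ s t =
      -crossAmbiguity (∂_{v} φ) ψ s t - crossAmbiguity φ (∂_{v} ψ) s t := by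
  have h_int := integrable_crossAmbiguity φ ψ s t
  have h_int_left := integrable_crossAmbiguity (∂_{v} φ) ψ s t
  have h_int_right := integrable_crossAmbiguity φ (∂_{v} ψ) s t
  have h_parts := integral_bilinear_hasLineDerivAt_right_eq_neg_left_of_integrable
    (μ := volume) (B := ContinuousLinearMap.mul ℝ ℂ)
    (by simpa only [ContinuousLinearMap.mul_apply', mul_right_comm] using h_int.mul_const _)
    (by
      simp only [ContinuousLinearMap.mul_apply', mul_add]
      exact h_int_left.add h_int_right)
    h_int (fun x _ => hasLineDerivAt_exp_dotProduct s t v x)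
    (fun x _ => hasLineDerivAt_conj_mul_translate φ ψ s v x)
  simp only [ContinuousLinearMap.mul_apply', mul_right_comm _ (Complex.I * _), mul_add] at h_parts
  rw [integral_add h_int_left h_int_right, integral_mul_const] at h_parts
  simp only [crossAmbiguity]
  linear_combination h_parts

/-- A weight `w(s, t)` is admissible if all products of `w` with cross-ambiguity functions of
Schwartz functions are bounded. Admissible weights are closed under addition and under
multiplication with the coordinates of `s` and `t`, which is how the decay is proved. -/
def IsAdmissibleWeight (w : (Fin n → ℝ) → (Fin n → ℝ) → ℝ) : Prop :=
  ∀ φ ψ : 𝓢(Fin n → ℝ, ℂ), ∃ C, ∀ s t, ‖w s t * crossAmbiguity φ ψ s t‖ ≤ C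

theorem isAdmissibleWeight_one : IsAdmissibleWeight (n := n) fun _ _ => 1 := fun φ ψ =>
  ⟨_, fun s t => by
    rw [Complex.ofReal_one, one_mul]
    exact norm_crossAmbiguity_le φ ψ s t⟩

namespace IsAdmissibleWeight

variable {w w' : (Fin n → ℝ) → (Fin n → ℝ) → ℝ}

theorem add (h : IsAdmissibleWeight w) (h' : IsAdmissibleWeight w') :
    IsAdmissibleWeight fun s t => w s t + w' s t := fun φ ψ => by
  obtain ⟨C, hC⟩ := h φ ψ
  obtain ⟨C', hC'⟩ := h' φ ψ
  refine ⟨C + C', fun s t => ?_⟩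
  rw [Complex.ofReal_add, add_mul]
  exact (norm_add_le _ _).trans (add_le_add (hC s t) (hC' s t))

theorem coord_mul (h : IsAdmissibleWeight w) (i : Fin n) :
    IsAdmissibleWeight fun s t => s i * w s t := fun φ ψ => by
  obtain ⟨C, hC⟩ := h (mulCoord i φ) ψ
  obtain ⟨C', hC'⟩ := h φ (mulCoord i ψ)
  refine ⟨C + C', fun s t => ?_⟩
  rw [Complex.ofReal_mul, mul_comm (s i : ℂ), mul_assoc, coord_mul_crossAmbiguity, mul_sub]
  exact (norm_sub_le _ _).trans (add_le_add (hC s t) (hC' s t))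

theorem freq_mul (h : IsAdmissibleWeight w) (i : Fin n) :
    IsAdmissibleWeight fun s t => t i * w s t := fun φ ψ => by
  obtain ⟨C, hC⟩ := h (∂_{(Pi.single i 1 : Fin n → ℝ)} φ) ψ
  obtain ⟨C', hC'⟩ := h φ (∂_{(Pi.single i 1 : Fin n → ℝ)} ψ)
  refine ⟨C + C', fun s t => ?_⟩
  have h_freq := freq_mul_crossAmbiguity φ ψ s t (Pi.single i 1)
  rw [dotProduct_single, mul_one] at h_freq
  have h_weight : (t i * w s t : ℝ) * crossAmbiguity φ ψ s t =
      Complex.I * (w s t * crossAmbiguity (∂_{(Pi.single i 1 : Fin n → ℝ)} φ) ψ s t +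
        w s t * crossAmbiguity φ (∂_{(Pi.single i 1 : Fin n → ℝ)} ψ) s t) := by
    rw [Complex.ofReal_mul]
    linear_combination (-Complex.I * w s t) * h_freq +
      (t i * w s t * crossAmbiguity φ ψ s t) * Complex.I_sq
  rw [h_weight, norm_mul, Complex.norm_I, one_mul]
  exact (norm_add_le _ _).trans (add_le_add (hC s t) (hC' s t))

end IsAdmissibleWeight

theorem isAdmissibleWeight_prod_one_add_sq (S S' : Finset (Fin n)) :
    IsAdmissibleWeight fun s t => (∏ i ∈ S, (1 + s i ^ 2)) * ∏ i ∈ S', (1 + t i ^ 2) := by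
  classical
  induction S using Finset.induction_on with
  | empty =>
    induction S' using Finset.induction_on with
    | empty => simpa using isAdmissibleWeight_one
    | insert i S' hi ih =>
      convert ih.add ((ih.freq_mul i).freq_mul i) using 3
      rw [Finset.prod_insert hi]
      ring
  | insert i S hi ih =>
    convert ih.add ((ih.coord_mul i).coord_mul i) using 3
    rw [Finset.prod_insert hi]
    ring

theorem norm_inner_toLp_T_toLp (d : ℕ) (φ ψ : 𝓢(Fin n → ℝ, ℂ)) (a : Phase ℝ n) :
    ‖⟪φ.toLp 2, T d a (ψ.toLp 2)⟫_ℂ‖ =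
      ‖crossAmbiguity φ ψ (ell d • a.1) (ell d • a.2)‖ := by
  have h_inner : ⟪φ.toLp 2, T d a (ψ.toLp 2)⟫_ℂ =
      Circle.exp (Real.pi * (a.1 ⬝ᵥ a.2) / d) *
        crossAmbiguity φ ψ (ell d • a.1) (ell d • a.2) := by
    rw [L2.inner_def, crossAmbiguity, ← integral_const_mul]
    refine integral_congr_ae ?_
    filter_upwards [φ.coeFn_toLp 2 volume, coeFn_T d a (ψ.toLp 2),
      (measurePreserving_sub_right volume (ell d • a.1)).quasiMeasurePreserving.ae
        (ψ.coeFn_toLp 2 volume)] with x h_left h_T h_right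
    rw [h_left, h_T, h_right, RCLike.inner_apply, Circle.exp_add, Circle.coe_mul]
    ring
  rw [h_inner, norm_mul, Circle.norm_coe, one_mul]

theorem inFormDomain_schwartz {d : ℕ} (hd : 0 < d) (φ ψ : 𝓢(Fin n → ℝ, ℂ)) :
    InFormDomain d (φ.toLp 2) (ψ.toLp 2) := by
  obtain ⟨C, hC⟩ := isAdmissibleWeight_prod_one_add_sq Finset.univ Finset.univ φ ψ
  have h_summable := summable_prod_apply (fun a : ℤ => by positivity)
    (summable_inv_one_add_sq_mul_int (ell_pos hd)) n
  have h_summable₂ := h_summable.mul_of_nonneg h_summable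
    (fun a => Finset.prod_nonneg fun i _ => by positivity)
    (fun a => Finset.prod_nonneg fun i _ => by positivity)
  refine Summable.of_norm_bounded (h_summable₂.mul_left C) fun a => ?_
  have h_bound := hC (ell d • (toReal a).1) (ell d • (toReal a).2)
  rw [norm_mul, Complex.norm_real, Real.norm_of_nonneg (mul_nonneg
    (Finset.prod_nonneg fun i _ => by positivity) (Finset.prod_nonneg fun i _ => by positivity))]
    at h_bound
  rw [norm_inner_toLp_T_toLp]
  simp only [Finset.prod_inv_distrib]
  rw [← mul_inv, ← div_eq_mul_inv, le_div_iff₀ (mul_pos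
    (Finset.prod_pos fun i _ => by positivity) (Finset.prod_pos fun i _ => by positivity)),
    mul_comm]
  exact h_bound

end CrossAmbiguity

/-! ### States as mixtures of vectors -/

section Mixture

open InnerProductSpace

section HilbertSpace

variable {E ι κ : Type*} [NormedAddCommGroup E] [InnerProductSpace ℂ E]

theorem hasSum_norm_inner_sq (e : HilbertBasis κ ℂ E) (w : E) :
    HasSum (fun i => ‖⟪w, e i⟫_ℂ‖ ^ 2) (‖w‖ ^ 2) := by
  have h_re := Complex.hasSum_re (e.hasSum_inner_mul_inner w w)
  rw [← inner_self_eq_norm_sq (𝕜 := ℂ)]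
  refine h_re.congr_fun fun i => ?_
  rw [← inner_conj_symm (e i) w, Complex.mul_conj, Complex.ofReal_re, Complex.normSq_eq_norm_sq]

theorem summable_norm_inner_sq (e : HilbertBasis κ ℂ E) {w : ι → E}
    (hw : Summable fun j => ‖w j‖ ^ 2) :
    Summable fun p : ι × κ => ‖⟪w p.1, e p.2⟫_ℂ‖ ^ 2 := by
  rw [summable_prod_of_nonneg fun p => sq_nonneg _]
  exact ⟨fun j => (hasSum_norm_inner_sq e (w j)).summable,
    hw.congr fun j => (hasSum_norm_inner_sq e (w j)).tsum_eq.symm⟩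

theorem summable_norm_map_sq (A : E →L[ℂ] E) {v : ι → E} (hv : Summable fun j => ‖v j‖ ^ 2) :
    Summable fun j => ‖A (v j)‖ ^ 2 := by
  refine Summable.of_nonneg_of_le (fun _ => sq_nonneg _) (fun j => ?_) (hv.mul_left (‖A‖ ^ 2))
  rw [← mul_pow]
  exact pow_le_pow_left₀ (norm_nonneg _) (A.le_opNorm _) 2

theorem summable_rankOne [CompleteSpace E] {v : ι → E} (hv : Summable fun j => ‖v j‖ ^ 2) :
    Summable fun j => rankOne ℂ (v j) (v j) :=
  Summable.of_norm (hv.congr fun j => by rw [norm_rankOne, sq])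

/-- The operator `ρ = ∑ⱼ |vⱼ⟩⟨vⱼ|` is the mixture of the square-summable family of (unnormalised)
vectors `vⱼ`. -/
structure IsMixture (v : ι → E) (ρ : E →L[ℂ] E) : Prop where
  summable_norm_sq : Summable fun j => ‖v j‖ ^ 2
  hasSum_rankOne : HasSum (fun j => rankOne ℂ (v j) (v j)) ρ

theorem IsMixture.hasSum_inner {v : ι → E} {ρ : E →L[ℂ] E} (h : IsMixture v ρ) (x y : E) :
    HasSum (fun j => ⟪x, v j⟫_ℂ * ⟪v j, y⟫_ℂ) ⟪x, ρ y⟫_ℂ := by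
  have h_inner := (h.hasSum_rankOne.mapL (ContinuousLinearMap.apply ℂ E y)).mapL (innerSL ℂ x)
  simpa only [ContinuousLinearMap.apply_apply, rankOne_apply, innerSL_apply_apply,
    inner_smul_right, mul_comm] using h_inner

theorem isMixture_of_hasSum_inner [CompleteSpace E] {v : ι → E} {ρ : E →L[ℂ] E}
    (hv : Summable fun j => ‖v j‖ ^ 2)
    (hρ : ∀ x y, HasSum (fun j => ⟪x, v j⟫_ℂ * ⟪v j, y⟫_ℂ) ⟪x, ρ y⟫_ℂ) : IsMixture v ρ := by
  have h_tsum : IsMixture v (∑' j, rankOne ℂ (v j) (v j)) := ⟨hv, (summable_rankOne hv).hasSum⟩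
  convert h_tsum using 1
  exact ContinuousLinearMap.ext fun y => ext_inner_left ℂ fun x =>
    (hρ x y).unique (h_tsum.hasSum_inner x y)

theorem IsMixture.summable_inner_mul_inner {v : ι → E} {ρ : E →L[ℂ] E} (h : IsMixture v ρ)
    (e : HilbertBasis κ ℂ E) (A : E →L[ℂ] E) :
    Summable fun p : ι × κ => ⟪A (v p.1), e p.2⟫_ℂ * ⟪e p.2, v p.1⟫_ℂ := by
  refine Summable.of_norm_bounded
    ((summable_norm_inner_sq e (summable_norm_map_sq A h.summable_norm_sq)).add
      (summable_norm_inner_sq e h.summable_norm_sq)) fun p => ?_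
  rw [norm_mul, norm_inner_symm (e p.2)]
  nlinarith [two_mul_le_add_sq ‖⟪A (v p.1), e p.2⟫_ℂ‖ ‖⟪v p.1, e p.2⟫_ℂ‖,
    sq_nonneg ‖⟪A (v p.1), e p.2⟫_ℂ‖, sq_nonneg ‖⟪v p.1, e p.2⟫_ℂ‖]

variable [CompleteSpace E]

theorem IsMixture.hasSum_inner_comp {v : ι → E} {ρ : E →L[ℂ] E} (h : IsMixture v ρ)
    (e : HilbertBasis κ ℂ E) (A : E →L[ℂ] E) :
    HasSum (fun j => ⟪v j, A (v j)⟫_ℂ) (∑' i, ⟪e i, (ρ ∘L A) (e i)⟫_ℂ) := by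
  let A' := ContinuousLinearMap.adjoint A
  have h_double := (h.summable_inner_mul_inner e A').hasSum
  have h_rows := h_double.prod_fiberwise fun j => e.hasSum_inner_mul_inner (A' (v j)) (v j)
  have h_columns := ((Equiv.prodComm κ ι).hasSum_iff.2 h_double).prod_fiberwise fun i =>
    (h.hasSum_inner (e i) (A (e i))).congr_fun fun j => by
      simp only [A', Function.comp_apply, Equiv.prodComm_apply, Prod.fst_swap, Prod.snd_swap,
        ContinuousLinearMap.adjoint_inner_left, mul_comm]
  simp only [ContinuousLinearMap.comp_apply, h_columns.tsum_eq]
  exact h_rows.congr_fun fun j => (ContinuousLinearMap.adjoint_inner_left A (v j) (v j)).symm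

theorem exists_inner_map_eq_inner_map_map {ρ : E →L[ℂ] E} (hρ : ρ.IsPositive) :
    ∃ B : E →L[ℂ] E, B.IsSymmetric ∧ ∀ x y, ⟪B x, B y⟫_ℂ = ⟪x, ρ y⟫_ℂ := by
  have h_sqrt : CFC.sqrt ρ * CFC.sqrt ρ = ρ :=
    CFC.sqrt_mul_sqrt_self ρ ((ContinuousLinearMap.nonneg_iff_isPositive ρ).2 hρ)
  have h_symm : (CFC.sqrt ρ).IsSymmetric :=
    ((ContinuousLinearMap.nonneg_iff_isPositive _).1 (CFC.sqrt_nonneg ρ)).isSymmetric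
  refine ⟨CFC.sqrt ρ, h_symm, fun x y => (h_symm x _).trans ?_⟩
  exact congrArg (fun A : E →L[ℂ] E => ⟪x, A y⟫_ℂ) h_sqrt

theorem exists_isMixture (e : HilbertBasis κ ℂ E) {ρ : E →L[ℂ] E} (hρ : ρ.IsPositive)
    (h_trace : Summable fun i => ⟪e i, ρ (e i)⟫_ℂ) : ∃ v : κ → E, IsMixture v ρ := by
  obtain ⟨B, hB_symm, hB⟩ := exists_inner_map_eq_inner_map_map hρ
  refine ⟨fun j => B (e j), isMixture_of_hasSum_inner ?_ fun x y => ?_⟩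
  · refine (Complex.hasSum_re h_trace.hasSum).summable.congr fun j => ?_
    rw [← hB, ← inner_self_eq_norm_sq (𝕜 := ℂ), RCLike.re_eq_complex_re]
  · rw [← hB]
    refine (e.hasSum_inner_mul_inner (B x) (B y)).congr_fun fun j => ?_
    exact congrArg₂ (· * ·) (hB_symm x (e j)).symm (hB_symm (e j) y)

end HilbertSpace

variable {n m k : ℕ} {ι κ : Type*}

theorem IsMixture.hasSum_trace_comp {v : ι → Hilb n} {ρ : Hilb n →L[ℂ] Hilb n}
    (h : IsMixture v ρ) (A : Hilb n →L[ℂ] Hilb n) :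
    HasSum (fun j => ⟪v j, A (v j)⟫_ℂ) (trace (ρ ∘L A)) :=
  h.hasSum_inner_comp (basis n) A

theorem IsState.exists_isMixture {ρ : Hilb n →L[ℂ] Hilb n} (h : IsState ρ) :
    ∃ v : basisIndex n → Hilb n, IsMixture v ρ :=
  ZakGross.exists_isMixture (basis n) h.1 (h.2 _ (basis n)).summable

theorem norm_tensorVec (f : Hilb m) (g : Hilb k) : ‖tensorVec f g‖ = ‖f‖ * ‖g‖ := by
  rw [← tensorMap_tmul, norm_tensorMap, TensorProduct.norm_tmul]

theorem ext_inner_tensorVec {u v : Hilb (m + k)}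
    (h : ∀ f g, ⟪tensorVec f g, u⟫_ℂ = ⟪tensorVec f g, v⟫_ℂ) : u = v := by
  refine innerSL_inj (𝕜 := ℂ).1 (clm_ext_tensorVec fun f g => ?_)
  rw [innerSL_apply_apply, innerSL_apply_apply, ← inner_conj_symm, h, inner_conj_symm]

theorem hasSum_mul_prod {f : ι → ℂ} {g : κ → ℂ} {s t : ℂ} (hf : HasSum f s) (hg : HasSum g t) :
    HasSum (fun p : ι × κ => f p.1 * g p.2) (s * t) :=
  hf.mul hg (summable_mul_of_summable_norm hf.summable.norm hg.summable.norm)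

theorem IsMixture.tensorOp {v : ι → Hilb m} {w : κ → Hilb k} {ρ : Hilb m →L[ℂ] Hilb m}
    {σ : Hilb k →L[ℂ] Hilb k} (hρ : IsMixture v ρ) (hσ : IsMixture w σ) :
    IsMixture (fun p : ι × κ => tensorVec (v p.1) (w p.2)) (ZakGross.tensorOp ρ σ) := by
  have h_summable : Summable fun p : ι × κ => ‖tensorVec (v p.1) (w p.2)‖ ^ 2 := by
    simp only [norm_tensorVec, mul_pow]
    exact hρ.summable_norm_sq.mul_of_nonneg hσ.summable_norm_sq (fun _ => sq_nonneg _)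
      fun _ => sq_nonneg _
  have h_tsum : IsMixture (fun p : ι × κ => tensorVec (v p.1) (w p.2)) _ :=
    ⟨h_summable, (summable_rankOne h_summable).hasSum⟩
  convert h_tsum using 1
  refine clm_ext_tensorVec fun f g => ext_inner_tensorVec fun f' g' => ?_
  refine HasSum.unique ?_ (h_tsum.hasSum_inner (tensorVec f' g') (tensorVec f g))
  rw [tensorOp_tensorVec, inner_tensorVec]
  simp only [inner_tensorVec, mul_mul_mul_comm]
  exact (hasSum_mul_prod (hρ.hasSum_inner f' f) (hσ.hasSum_inner g' g) :)

theorem trace_tensorOp_T {ρ : Hilb m →L[ℂ] Hilb m} {σ : Hilb k →L[ℂ] Hilb k}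
    (hρ : IsState ρ) (hσ : IsState σ) (d : ℕ) (a : Phase ℤ (m + k)) :
    trace (tensorOp ρ σ ∘L T d (toReal a)) =
      trace (ρ ∘L T d (toReal (fstModes a))) * trace (σ ∘L T d (toReal (sndModes a))) := by
  obtain ⟨v, hv⟩ := hρ.exists_isMixture
  obtain ⟨w, hw⟩ := hσ.exists_isMixture
  have h_fst := hv.hasSum_trace_comp (T d (toReal (fstModes a)))
  have h_snd := hw.hasSum_trace_comp (T d (toReal (sndModes a)))
  have h_tensor := (hv.tensorOp hw).hasSum_trace_comp (T d (toReal a))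
  simp only [inner_tensorVec_T] at h_tensor
  exact h_tensor.unique (hasSum_mul_prod h_fst h_snd :)

end Mixture

/-! ### Uniqueness of Fourier series -/

section Uniqueness

theorem ae_eq_zero_of_forall_integral_continuousMap_mul_eq_zero {Y : Type*} [MeasurableSpace Y]
    [TopologicalSpace Y] [HasOuterApproxClosed Y] [BorelSpace Y] {ν : Measure Y} {W : Y → ℂ}
    (hW : Integrable W ν) (h : ∀ φ : C(Y, ℂ), ∫ y, φ y * W y ∂ν = 0) : W =ᵐ[ν] 0 := by
  refine ae_eq_zero_of_forall_setIntegral_isClosed_eq_zero hW fun s hs => ?_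
  have h_tendsto : Tendsto (fun j => ∫ y, ((hs.apprSeq j y : ℝ) : ℂ) * W y ∂ν) atTop
      (𝓝 (∫ y, s.indicator W y ∂ν)) := by
    refine tendsto_integral_of_dominated_convergence (fun y => ‖W y‖)
      (fun j => AEStronglyMeasurable.mul (by fun_prop) hW.1) hW.norm
      (fun j => Eventually.of_forall fun y => ?_) (Eventually.of_forall fun y => ?_)
    · rw [norm_mul, Complex.norm_real, NNReal.norm_eq]
      exact mul_le_of_le_one_left (norm_nonneg _) (HasOuterApproxClosed.apprSeq_apply_le_one hs j y)
    · have h_lim := ((Complex.continuous_ofReal.comp NNReal.continuous_coe).tendsto _).comp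
        (tendsto_pi_nhds.1 (HasOuterApproxClosed.tendsto_apprSeq hs) y)
      have h_indicator : s.indicator W y =
          (((s.indicator (fun _ => 1) y : NNReal) : ℝ) : ℂ) * W y := by
        by_cases hy : y ∈ s <;> simp [hy]
      rw [h_indicator]
      exact h_lim.mul_const (W y)
  rw [← integral_indicator hs.measurableSet]
  refine tendsto_nhds_unique h_tendsto (tendsto_const_nhds.congr fun j => (h ⟨_, ?_⟩).symm)
  exact Complex.continuous_ofReal.comp (by fun_prop)

/-- Integration against an integrable function, as a continuous linear functional on the space of
continuous functions on a compact space. -/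
def integralMulCLM {Y : Type*} [MeasurableSpace Y] [TopologicalSpace Y] [CompactSpace Y]
    [BorelSpace Y] {ν : Measure Y} {W : Y → ℂ} (hW : Integrable W ν) : C(Y, ℂ) →L[ℂ] ℂ :=
  have h_int (φ : C(Y, ℂ)) : Integrable (fun y => φ y * W y) ν :=
    hW.bdd_mul (by fun_prop) (Eventually.of_forall φ.norm_coe_le_norm)
  LinearMap.mkContinuous
    { toFun := fun φ => ∫ y, φ y * W y ∂ν
      map_add' := fun φ φ' => by
        rw [← integral_add (h_int φ) (h_int φ')]
        simp only [ContinuousMap.add_apply, add_mul]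
      map_smul' := fun c φ => by
        rw [RingHom.id_apply, smul_eq_mul, ← integral_const_mul]
        simp only [ContinuousMap.smul_apply, smul_eq_mul, mul_assoc] }
    (∫ y, ‖W y‖ ∂ν) fun φ => by
      rw [mul_comm, ← integral_const_mul]
      refine norm_integral_le_of_norm_le (hW.norm.const_mul _) (Eventually.of_forall fun y => ?_)
      rw [norm_mul]
      exact mul_le_mul_of_nonneg_right (φ.norm_coe_le_norm y) (norm_nonneg _)

theorem ae_eq_zero_of_forall_integral_mFourier_mul_eq_zero {ι : Type*} [Fintype ι]
    {ν : Measure (UnitAddTorus ι)} {W : UnitAddTorus ι → ℂ} (hW : Integrable W ν)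
    (h : ∀ c, ∫ y, UnitAddTorus.mFourier c y * W y ∂ν = 0) : W =ᵐ[ν] 0 := by
  refine ae_eq_zero_of_forall_integral_continuousMap_mul_eq_zero hW fun φ => ?_
  have h_le : (Submodule.span ℂ (Set.range (UnitAddTorus.mFourier (d := ι)))).topologicalClosure ≤
      LinearMap.ker (integralMulCLM hW : C(UnitAddTorus ι, ℂ) →ₗ[ℂ] ℂ) :=
    Submodule.topologicalClosure_minimal _
      (Submodule.span_le.2 (by rintro _ ⟨c, rfl⟩; exact h c)) (integralMulCLM hW).isClosed_ker
  rw [UnitAddTorus.span_mFourier_closure_eq_top] at h_le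
  exact h_le (Submodule.mem_top (x := φ))

theorem ae_eq_zero_of_forall_integral_mFourier_comp_mul_eq_zero {X ι : Type*} [MeasurableSpace X]
    [StandardBorelSpace X] [Fintype ι] {μ : Measure X} {ψ : X → UnitAddTorus ι}
    (h_meas : Measurable ψ) (h_inj : ψ.Injective) {V : X → ℂ} (hV : Integrable V μ)
    (h : ∀ c, ∫ x, UnitAddTorus.mFourier c (ψ x) * V x ∂μ = 0) : V =ᵐ[μ] 0 := by
  have h_emb : MeasurableEmbedding ψ := h_meas.measurableEmbedding h_inj
  have h_extend (x : X) : Function.extend ψ V 0 (ψ x) = V x := h_inj.extend_apply V 0 x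
  have h_zero : Function.extend ψ V 0 =ᵐ[μ.map ψ] 0 := by
    refine ae_eq_zero_of_forall_integral_mFourier_mul_eq_zero ?_ fun c => ?_
    · exact h_emb.integrable_map_iff.2 (by simpa only [Function.comp_def, h_extend] using hV)
    · simpa only [h_emb.integral_map, h_extend] using h c
  filter_upwards [h_emb.ae_map_iff.1 h_zero] with x hx
  rwa [h_extend] at hx

end Uniqueness

/-! ### The fundamental cell and its characters -/

section Cell

variable {d n : ℕ}

theorem mul_ell_pos (hd : 0 < d) : 0 < d * ell d :=
  mul_pos (Nat.cast_pos.2 hd) (ell_pos hd)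

/-- The box `[0, dℓ)ⁿ` in configuration space. -/
def box (d n : ℕ) : Set (Fin n → ℝ) := Set.univ.pi fun _ => Set.Ico 0 (d * ell d)

theorem cell_eq_box_prod_box : cell d n = box d n ×ˢ box d n := by
  ext η
  simp [cell, box, Set.mem_pi]

theorem measurableSet_box : MeasurableSet (box d n) :=
  MeasurableSet.univ_pi fun _ => measurableSet_Ico

theorem measurableSet_cell : MeasurableSet (cell d n) := by
  rw [cell_eq_box_prod_box]
  exact measurableSet_box.prod measurableSet_box

theorem volume_restrict_cell : (volume : Measure (Phase ℝ n)).restrict (cell d n) =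
    (volume.restrict (box d n)).prod (volume.restrict (box d n)) := by
  rw [cell_eq_box_prod_box, Measure.prod_restrict]
  rfl

instance isFiniteMeasure_restrict_box :
    IsFiniteMeasure ((volume : Measure (Fin n → ℝ)).restrict (box d n)) := by
  rw [box, volume_pi, Measure.restrict_pi_pi]
  infer_instance

instance isFiniteMeasure_restrict_cell :
    IsFiniteMeasure ((volume : Measure (Phase ℝ n)).restrict (cell d n)) := by
  rw [volume_restrict_cell]
  infer_instance

/-- The character `x ↦ exp(iℓ u · x)` of configuration space, for `u ∈ ℤⁿ`. -/
def boxChar (d : ℕ) (u : Fin n → ℤ) (x : Fin n → ℝ) : Circle :=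
  Circle.exp (ell d * ((fun i => (u i : ℝ)) ⬝ᵥ x))

theorem continuous_boxChar (u : Fin n → ℤ) : Continuous fun x => (boxChar d u x : ℂ) := by
  unfold boxChar dotProduct
  fun_prop

theorem boxChar_add_left (u v : Fin n → ℤ) (x : Fin n → ℝ) :
    boxChar d (u + v) x = boxChar d u x * boxChar d v x := by
  simp only [boxChar, ← Circle.exp_add, dotProduct, Pi.add_apply, Int.cast_add, add_mul,
    Finset.sum_add_distrib, mul_add]

theorem coe_boxChar_eq_prod (u : Fin n → ℤ) (x : Fin n → ℝ) :
    (boxChar d u x : ℂ) = ∏ i, (Circle.exp (ell d * (u i * x i)) : ℂ) := by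
  simp only [boxChar, dotProduct, Circle.coe_exp, Finset.mul_sum, Complex.ofReal_sum,
    Finset.sum_mul, Complex.exp_sum]

theorem latticeChar_eq_boxChar_mul (a : Phase ℤ n) (η : Phase ℝ n) :
    latticeChar d a η = boxChar d (-a.2) η.1 * boxChar d a.1 η.2 := by
  simp only [latticeChar, boxChar, ← Circle.exp_add, symp, toReal, dotProduct, Pi.neg_apply,
    Int.cast_neg, neg_mul, Finset.sum_neg_distrib]
  congr 1
  ring

theorem continuous_latticeChar (a : Phase ℤ n) :
    Continuous fun η => (latticeChar d a η : ℂ) := by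
  unfold latticeChar symp dotProduct
  fun_prop

theorem latticeChar_add_left (a b : Phase ℤ n) (η : Phase ℝ n) :
    latticeChar d (a + b) η = latticeChar d a η * latticeChar d b η := by
  simp only [latticeChar_eq_boxChar_mul, Prod.fst_add, Prod.snd_add, neg_add, boxChar_add_left]
  exact mul_mul_mul_comm _ _ _ _

theorem integrable_latticeChar_mul (a : Phase ℤ n) {μ : Measure (Phase ℝ n)} {W : Phase ℝ n → ℂ}
    (hW : Integrable W μ) : Integrable (fun η => latticeChar d a η * W η) μ :=
  hW.bdd_mul (c := 1)
    (continuous_latticeChar a).aestronglyMeasurable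
    (Eventually.of_forall fun _ => (Circle.norm_coe _).le)

theorem setIntegral_Ico_exp (hd : 0 < d) (u : ℤ) :
    ∫ x in Set.Ico 0 (d * ell d), (Circle.exp (ell d * (u * x)) : ℂ) =
      if u = 0 then ((d * ell d : ℝ) : ℂ) else 0 := by
  rw [integral_Ico_eq_integral_Ioc, ← intervalIntegral.integral_of_le (mul_ell_pos hd).le]
  split_ifs with hu
  · simp [hu]
  · have h_period : (ell d * u * Complex.I : ℂ) * ((d * ell d : ℝ) : ℂ) =
        u * (2 * Real.pi * Complex.I) := by
      have h_sq : (d * (ell d * ell d) : ℂ) = 2 * Real.pi := mod_cast mul_ell_mul_ell hd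
      push_cast
      linear_combination (u * Complex.I) * h_sq
    have h_freq : (ell d * u * Complex.I : ℂ) ≠ 0 :=
      mul_ne_zero (mul_ne_zero (mod_cast (ell_pos hd).ne') (mod_cast hu)) Complex.I_ne_zero
    have h_exp (x : ℝ) : (Circle.exp (ell d * (u * x)) : ℂ) =
        Complex.exp (ell d * u * Complex.I * x) := by
      rw [Circle.coe_exp]
      push_cast
      ring_nf
    simp only [h_exp]
    rw [integral_exp_mul_complex h_freq, h_period, Complex.exp_int_mul_two_pi_mul_I,
      Complex.ofReal_zero, mul_zero, Complex.exp_zero, sub_self, zero_div]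

theorem setIntegral_boxChar (hd : 0 < d) (u : Fin n → ℤ) :
    ∫ x in box d n, (boxChar d u x : ℂ) = if u = 0 then ((d * ell d : ℝ) : ℂ) ^ n else 0 := by
  simp only [coe_boxChar_eq_prod]
  rw [box, volume_pi, Measure.restrict_pi_pi, integral_fintype_prod_eq_prod
    (f := fun i (x : ℝ) => (Circle.exp (ell d * (u i * x)) : ℂ))]
  simp only [setIntegral_Ico_exp hd]
  split_ifs with hu
  · simp [hu]
  · obtain ⟨i, hi⟩ := Function.ne_iff.1 hu
    exact Finset.prod_eq_zero (Finset.mem_univ i) (if_neg hi)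

theorem setIntegral_latticeChar (hd : 0 < d) (a : Phase ℤ n) :
    ∫ η in cell d n, (latticeChar d a η : ℂ) =
      if a = 0 then ((d * ell d : ℝ) : ℂ) ^ (2 * n) else 0 := by
  simp only [latticeChar_eq_boxChar_mul, Circle.coe_mul]
  rw [volume_restrict_cell, integral_prod_mul (fun x => (boxChar d (-a.2) x : ℂ))
    (fun x => (boxChar d a.1 x : ℂ)), setIntegral_boxChar hd, setIntegral_boxChar hd]
  by_cases h₁ : a.1 = 0 <;> by_cases h₂ : a.2 = 0 <;>
    simp [Prod.ext_iff, h₁, h₂, two_mul, pow_add]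

/-- The map of phase space onto the torus which identifies `cell d n` with the torus. -/
def toTorus (d n : ℕ) (η : Phase ℝ n) : UnitAddTorus (Fin n ⊕ Fin n) :=
  Sum.elim (fun i => ((η.1 i / (d * ell d) : ℝ) : UnitAddCircle))
    fun i => ((η.2 i / (d * ell d) : ℝ) : UnitAddCircle)

theorem measurable_toTorus : Measurable (toTorus d n) := by
  refine measurable_pi_iff.2 (Sum.rec (fun i => ?_) fun i => ?_)
  · exact AddCircle.measurable_mk'.comp
      (((measurable_pi_apply i).comp measurable_fst).div_const _)
  · exact AddCircle.measurable_mk'.comp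
      (((measurable_pi_apply i).comp measurable_snd).div_const _)

theorem injOn_toTorus (hd : 0 < d) : Set.InjOn (toTorus d n) (cell d n) := by
  have hL := mul_ell_pos hd
  have h_Ico {x : ℝ} (hx : x ∈ Set.Ico 0 (d * ell d)) :
      x / (d * ell d) ∈ Set.Ico (0 : ℝ) (0 + 1) :=
    ⟨div_nonneg hx.1 hL.le, by rw [zero_add, div_lt_one hL]; exact hx.2⟩
  have h_inj {x y : ℝ} (hx : x ∈ Set.Ico 0 (d * ell d)) (hy : y ∈ Set.Ico 0 (d * ell d))
      (h : ((x / (d * ell d) : ℝ) : UnitAddCircle) = ((y / (d * ell d) : ℝ) : UnitAddCircle)) :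
      x = y :=
    (div_left_inj' hL.ne').1 ((AddCircle.coe_eq_coe_iff_of_mem_Ico (h_Ico hx) (h_Ico hy)).1 h)
  intro η hη η' hη' h
  refine Prod.ext (funext fun i => ?_) (funext fun i => ?_)
  · exact h_inj (hη.1 i) (hη'.1 i) (congrFun h (Sum.inl i))
  · exact h_inj (hη.2 i) (hη'.2 i) (congrFun h (Sum.inr i))

theorem fourier_div_mul_ell (hd : 0 < d) (u : ℤ) (x : ℝ) :
    fourier u ((x / (d * ell d) : ℝ) : UnitAddCircle) = (Circle.exp (ell d * (u * x)) : ℂ) := by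
  have h_freq : 2 * Real.pi * u * (x / (d * ell d)) = ell d * (u * x) := by
    have h_ell := (ell_pos hd).ne'
    rw [← mul_ell_mul_ell hd]
    field_simp
  rw [fourier_coe_apply, Circle.coe_exp, ← h_freq]
  push_cast
  ring_nf

theorem mFourier_toTorus (hd : 0 < d) (c : Fin n ⊕ Fin n → ℤ) (η : Phase ℝ n) :
    UnitAddTorus.mFourier c (toTorus d n η) =
      latticeChar d (fun i => c (Sum.inr i), fun i => -c (Sum.inl i)) η := by
  have h_prod : UnitAddTorus.mFourier c (toTorus d n η) =
    ∏ j, fourier (c j) (toTorus d n η j) := rfl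
  rw [h_prod, latticeChar_eq_boxChar_mul, Circle.coe_mul, coe_boxChar_eq_prod,
    coe_boxChar_eq_prod, Fintype.prod_sum_type]
  simp only [toTorus, Sum.elim_inl, Sum.elim_inr, fourier_div_mul_ell hd, Pi.neg_apply, neg_neg]

end Cell

/-! ### Fourier series on the cell -/

section FourierSeries

variable {d n m k : ℕ}

/-- The function `W` is integrable on `cell d n` and has the Fourier series
`∑ₐ cₐ exp(iℓ[a, η])` there. -/
def HasFourierSeries (d : ℕ) (c : Phase ℤ n → ℂ) (W : Phase ℝ n → ℂ) : Prop :=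
  IntegrableOn W (cell d n) ∧
    ∀ a, ∫ η in cell d n, latticeChar d (-a) η * W η = ((d * ell d : ℝ) : ℂ) ^ (2 * n) * c a

theorem HasFourierSeries.ae_eq (hd : 0 < d) {c : Phase ℤ n → ℂ} {W W' : Phase ℝ n → ℂ}
    (h : HasFourierSeries d c W) (h' : HasFourierSeries d c W') :
    W =ᵐ[volume.restrict (cell d n)] W' := by
  have h_coeff (a : Phase ℤ n) : ∫ η in cell d n, latticeChar d a η * (W η - W' η) = 0 := by
    simp only [mul_sub]
    rw [integral_sub (integrable_latticeChar_mul a h.1) (integrable_latticeChar_mul a h'.1),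
      ← neg_neg a, h.2, h'.2, sub_self]
  have := (measurableSet_cell (d := d) (n := n)).standardBorel
  have h_zero := ae_eq_zero_of_forall_integral_mFourier_comp_mul_eq_zero
    (μ := Measure.comap Subtype.val volume) (ψ := fun η : cell d n => toTorus d n η)
    (V := fun η => W η - W' η) (measurable_toTorus.comp measurable_subtype_coe)
    (injOn_toTorus hd).injective
    ((integrableOn_iff_comap_subtypeVal measurableSet_cell).1 (h.1.sub h'.1)) fun c => by
      rw [integral_subtype_comap measurableSet_cell
        fun η => UnitAddTorus.mFourier c (toTorus d n η) * (W η - W' η)]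
      simp only [mFourier_toTorus hd, h_coeff]
  filter_upwards [(ae_restrict_iff_subtype (p := fun η => W η - W' η = 0) measurableSet_cell).2
    h_zero] with η hη
  exact sub_eq_zero.1 hη

theorem continuous_fourierSum {c : Phase ℤ n → ℂ} (hc : Summable c) :
    Continuous (fourierSum d c) :=
  continuous_tsum (fun a => (continuous_latticeChar a).mul_const _)
    hc.norm fun a η => by rw [norm_mul, Circle.norm_coe, one_mul]

theorem norm_fourierSum_le {c : Phase ℤ n → ℂ} (hc : Summable c) (η : Phase ℝ n) :
    ‖fourierSum d c η‖ ≤ ∑' a, ‖c a‖ := by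
  have h_norm (a : Phase ℤ n) : ‖(latticeChar d a η : ℂ) * c a‖ = ‖c a‖ := by
    rw [norm_mul, Circle.norm_coe, one_mul]
  rw [fourierSum, ← tsum_congr h_norm]
  exact norm_tsum_le_tsum_norm (summable_circle_mul (latticeChar d · η) hc).norm

theorem hasFourierSeries_fourierSum (hd : 0 < d) {c : Phase ℤ n → ℂ} (hc : Summable c) :
    HasFourierSeries d c (fourierSum d c) := by
  refine ⟨Integrable.of_bound (continuous_fourierSum hc).aestronglyMeasurable _
    (Eventually.of_forall (norm_fourierSum_le hc)), fun a => ?_⟩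
  have h_mul (η : Phase ℝ n) : latticeChar d (-a) η * fourierSum d c η =
      ∑' b, (latticeChar d (-a + b) η : ℂ) * c b := by
    simp only [fourierSum, ← tsum_mul_left, latticeChar_add_left, Circle.coe_mul, mul_assoc]
  have h_int (b : Phase ℤ n) : Integrable (fun η => (latticeChar d (-a + b) η : ℂ) * c b)
      (volume.restrict (cell d n)) :=
    integrable_latticeChar_mul _ (integrable_const _)
  have h_sum : Summable fun b => ∫ η in cell d n, ‖(latticeChar d (-a + b) η : ℂ) * c b‖ := by
    simp only [norm_mul, Circle.norm_coe, one_mul, integral_const, smul_eq_mul]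
    exact hc.norm.mul_left _
  simp only [h_mul]
  rw [← (hasSum_integral_of_summable_integral_norm h_int h_sum).tsum_eq, tsum_eq_single a]
  · rw [integral_mul_const, setIntegral_latticeChar hd, if_pos (neg_add_cancel a)]
  · intro b hb
    rw [integral_mul_const, setIntegral_latticeChar hd,
      if_neg fun h => hb (neg_add_eq_zero.1 h).symm, zero_mul]

theorem measurePreserving_prodProdProdComm {α β γ δ : Type*} [MeasureSpace α] [MeasureSpace β]
    [MeasureSpace γ] [MeasureSpace δ] [SigmaFinite (volume : Measure α)]
    [SigmaFinite (volume : Measure β)] [SigmaFinite (volume : Measure γ)]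
    [SigmaFinite (volume : Measure δ)] :
    MeasurePreserving (Equiv.prodProdProdComm α β γ δ) volume volume := by
  have h_assoc_left : MeasurePreserving (MeasurableEquiv.prodAssoc (α := α) (β := β) (γ := γ × δ))
    volume volume := volume_preserving_prodAssoc
  have h_assoc_middle : MeasurePreserving (MeasurableEquiv.prodAssoc (α := β) (β := γ) (γ := δ))
    volume volume := volume_preserving_prodAssoc
  have h_assoc_middle' : MeasurePreserving (MeasurableEquiv.prodAssoc (α := γ) (β := β) (γ := δ))
    volume volume := volume_preserving_prodAssoc
  have h_assoc_right : MeasurePreserving (MeasurableEquiv.prodAssoc (α := α) (β := γ) (γ := β × δ))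
    volume volume := volume_preserving_prodAssoc
  have h_swap : MeasurePreserving (Prod.map Prod.swap id : (β × γ) × δ → (γ × β) × δ)
    volume volume := Measure.measurePreserving_swap.prod (MeasurePreserving.id volume)
  have h_middle := (MeasurePreserving.id (volume : Measure α)).prod
    ((h_assoc_middle'.comp h_swap).comp h_assoc_middle.symm)
  exact (h_assoc_right.symm.comp h_middle).comp h_assoc_left

theorem measurePreserving_modes (m k : ℕ) :
    MeasurePreserving (modesEquiv ℝ m k) volume volume :=
  measurePreserving_prodProdProdComm.comp
    ((measurePreserving_split m k).prod (measurePreserving_split m k))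

theorem measurableEmbedding_modes (m k : ℕ) : MeasurableEmbedding (modesEquiv ℝ m k) :=
  (measurePreserving_modes m k).measurable.measurableEmbedding (modesEquiv ℝ m k).injective

theorem preimage_modes_cell : modesEquiv ℝ m k ⁻¹' (cell d m ×ˢ cell d k) = cell d (m + k) := by
  ext η
  simp only [Set.mem_preimage, modesEquiv_apply, Set.mem_prod, cell, Set.mem_ofPred_eq, fstModes,
    sndModes, left, right, Fin.forall_fin_add]
  tauto

theorem measurePreserving_modes_cell : MeasurePreserving (modesEquiv ℝ m k)
    (volume.restrict (cell d (m + k)))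
    ((volume.restrict (cell d m)).prod (volume.restrict (cell d k))) := by
  rw [Measure.prod_restrict, ← preimage_modes_cell]
  exact (measurePreserving_modes m k).restrict_preimage_emb (measurableEmbedding_modes m k) _

theorem setIntegral_cell_mul_modes {E : Type*} [RCLike E] (d : ℕ) (F : Phase ℝ m → E)
    (G : Phase ℝ k → E) :
    ∫ η in cell d (m + k), F (fstModes η) * G (sndModes η) =
      (∫ η in cell d m, F η) * ∫ η in cell d k, G η := by
  rw [← integral_prod_mul]
  exact measurePreserving_modes_cell.integral_comp (measurableEmbedding_modes m k)
    fun p => F p.1 * G p.2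

theorem HasFourierSeries.mul_modes {c : Phase ℤ m → ℂ} {c' : Phase ℤ k → ℂ} {W : Phase ℝ m → ℂ}
    {W' : Phase ℝ k → ℂ} (h : HasFourierSeries d c W) (h' : HasFourierSeries d c' W') :
    HasFourierSeries d (fun a => c (fstModes a) * c' (sndModes a))
      (fun η => W (fstModes η) * W' (sndModes η)) := by
  refine ⟨(measurePreserving_modes_cell.integrable_comp_emb (measurableEmbedding_modes m k)).2
    (h.1.mul_prod h'.1), fun a => ?_⟩
  have h_split (η : Phase ℝ (m + k)) :
      (latticeChar d (-a) η : ℂ) * (W (fstModes η) * W' (sndModes η)) =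
        latticeChar d (-fstModes a) (fstModes η) * W (fstModes η) *
          (latticeChar d (-sndModes a) (sndModes η) * W' (sndModes η)) := by
    rw [latticeChar_eq_mul_modes, Circle.coe_mul]
    exact mul_mul_mul_comm _ _ _ _
  simp only [h_split]
  rw [setIntegral_cell_mul_modes d (fun η => latticeChar d (-fstModes a) η * W η)
    (fun η => latticeChar d (-sndModes a) η * W' η), h.2, h'.2, mul_add, pow_add]
  exact mul_mul_mul_comm _ _ _ _

end FourierSeries

/-! ### Zak transforms -/

section Orthogonal

variable {ι E : Type*} [NormedAddCommGroup E] [InnerProductSpace ℂ E]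

theorem summable_of_pairwise_inner_eq_zero [CompleteSpace E] {z : ι → E}
    (hz : Pairwise fun i j => ⟪z i, z j⟫_ℂ = 0) (h_sq : Summable fun i => ‖z i‖ ^ 2) :
    Summable z := by
  have hV : OrthogonalFamily ℂ (fun i => Submodule.span ℂ {z i})
      fun i => (Submodule.span ℂ {z i}).subtypeₗᵢ :=
    OrthogonalFamily.of_pairwise fun i j hij => Submodule.isOrtho_span.2 fun u hu v hv => by
      rw [Set.mem_singleton_iff.1 hu, Set.mem_singleton_iff.1 hv]
      exact hz hij
  exact (hV.summable_iff_norm_sq_summable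
    fun i => ⟨z i, Submodule.mem_span_singleton_self _⟩).2 h_sq

theorem hasSum_norm_sq_of_pairwise_inner_eq_zero {z : ι → E} {x : E}
    (hz : Pairwise fun i j => ⟪z i, z j⟫_ℂ = 0) (hx : HasSum z x) :
    HasSum (fun i => ‖z i‖ ^ 2) (‖x‖ ^ 2) := by
  have h_inner (i : ι) : ⟪z i, x⟫_ℂ = ⟪z i, z i⟫_ℂ :=
    (hx.mapL (innerSL ℂ (z i))).unique (hasSum_single i fun j hj => hz hj.symm)
  have h_sum := Complex.hasSum_re (hx.mapL (innerSLFlip ℂ x))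
  simp only [innerSLFlip_apply_apply, h_inner, ← RCLike.re_eq_complex_re,
    inner_self_eq_norm_sq] at h_sum
  exact h_sum

end Orthogonal

section Tiling

variable {d n : ℕ}

/-- The lattice vector `ℓu`. -/
def latticeVec (d : ℕ) (u : Fin n → ℤ) : Fin n → ℝ := ell d • fun i => (u i : ℝ)

theorem latticeVec_add (u v : Fin n → ℤ) :
    latticeVec d (u + v) = latticeVec d u + latticeVec d v := by
  ext i
  simp [latticeVec, mul_add]

theorem existsUnique_sub_latticeVec_mem_box (hd : 0 < d) (x : Fin n → ℝ) :
    ∃! k : Fin n → ℤ, x - latticeVec d ((d : ℤ) • k) ∈ box d n := by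
  have h_coord (k : Fin n → ℤ) (i : Fin n) :
      (x - latticeVec d ((d : ℤ) • k)) i = x i - k i • (d * ell d) := by
    simp only [latticeVec, Pi.sub_apply, Pi.smul_apply, smul_eq_mul, zsmul_eq_mul, Int.cast_mul,
      Int.cast_natCast]
    ring
  have h_mem (k : Fin n → ℤ) : x - latticeVec d ((d : ℤ) • k) ∈ box d n ↔
      ∀ i, x i - k i • (d * ell d) ∈ Set.Ico 0 (0 + d * ell d) := by
    simp only [box, Set.mem_univ_pi, h_coord, zero_add]
  choose k hk h_unique using fun i => existsUnique_sub_zsmul_mem_Ico (mul_ell_pos hd) (x i) 0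
  exact ⟨k, (h_mem k).2 hk, fun k' hk' => funext fun i => h_unique i _ ((h_mem k').1 hk' i)⟩

theorem hasSum_setIntegral_box_add_latticeVec (hd : 0 < d) {h : (Fin n → ℝ) → ℂ}
    (hh : Integrable h) :
    HasSum (fun k : Fin n → ℤ => ∫ x in box d n, h (x + latticeVec d ((d : ℤ) • k)))
      (∫ x, h x) := by
  let tile (k : Fin n → ℤ) : Set (Fin n → ℝ) :=
    (fun x => x - latticeVec d ((d : ℤ) • k)) ⁻¹' box d n
  have h_meas (k : Fin n → ℤ) : MeasurableSet (tile k) :=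
    (measurable_id.sub_const _) measurableSet_box
  have h_disj : Pairwise (Function.onFun Disjoint tile) := fun k k' hkk' =>
    Set.disjoint_left.2 fun x hx hx' =>
      hkk' ((existsUnique_sub_latticeVec_mem_box hd x).unique hx hx')
  have h_univ : ⋃ k, tile k = Set.univ := Set.eq_univ_of_forall fun x =>
    Set.mem_iUnion.2 (existsUnique_sub_latticeVec_mem_box hd x).exists
  have h_sum := hasSum_integral_iUnion h_meas h_disj hh.integrableOn
  rw [h_univ, Measure.restrict_univ] at h_sum
  refine h_sum.congr_fun fun k => ?_
  rw [← (measurePreserving_sub_right volume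
    (latticeVec d ((d : ℤ) • k))).setIntegral_preimage_emb (measurableEmbedding_subRight _)
    (fun x => h (x + latticeVec d ((d : ℤ) • k))) (box d n)]
  simp only [sub_add_cancel, tile]

/-- Division with remainder by `d` in each coordinate. -/
def divModEquiv (d n : ℕ) [NeZero d] : (Fin n → ℤ) ≃ (Fin n → Fin d) × (Fin n → ℤ) :=
  ((Equiv.piCongrRight fun _ => Int.divModEquiv d).trans
    (Equiv.arrowProdEquivProdArrow _ _ _)).trans (Equiv.prodComm _ _)

theorem divModEquiv_symm_apply [NeZero d] (r : Fin n → Fin d) (k : Fin n → ℤ) :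
    (divModEquiv d n).symm (r, k) = (fun i => ((r i : ℕ) : ℤ)) + (d : ℤ) • k := by
  ext i
  simp [divModEquiv, Int.divModEquiv]
  ring

end Tiling

section Zak

variable {d n : ℕ}

theorem memLp_zakTerm (d : ℕ) (f : Hilb n) (u : Fin n → ℤ) :
    MemLp (fun η : Phase ℝ n => boxChar d (-u) η.2 * f (η.1 + latticeVec d u)) 2
      (volume.restrict (cell d n)) := by
  have h_shift : MemLp (fun η : Phase ℝ n => f (η.1 + latticeVec d u)) 2
      (volume.restrict (cell d n)) := by
    rw [volume_restrict_cell]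
    exact MemLp.comp_fst (((Lp.memLp f).comp_measurePreserving
      (measurePreserving_add_right volume (latticeVec d u))).restrict (box d n)) _
  refine h_shift.congr_norm (((continuous_boxChar (-u)).comp
    continuous_snd).aestronglyMeasurable.mul h_shift.1) (Eventually.of_forall fun η => ?_)
  rw [norm_mul, Circle.norm_coe, one_mul]

/-- The term `exp(-iℓ u · p) f(q + ℓu)` of the Zak transform of `f`. -/
def zakTerm (d : ℕ) (f : Hilb n) (u : Fin n → ℤ) :
    Lp ℂ 2 ((volume : Measure (Phase ℝ n)).restrict (cell d n)) :=
  (memLp_zakTerm d f u).toLp _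

theorem coeFn_zakTerm (d : ℕ) (f : Hilb n) (u : Fin n → ℤ) :
    zakTerm d f u =ᵐ[volume.restrict (cell d n)]
      fun η => boxChar d (-u) η.2 * f (η.1 + latticeVec d u) :=
  (memLp_zakTerm d f u).coeFn_toLp

theorem inner_zakTerm (hd : 0 < d) (f g : Hilb n) (u v : Fin n → ℤ) :
    ⟪zakTerm d f u, zakTerm d g v⟫_ℂ = if u = v then ((d * ell d : ℝ) : ℂ) ^ n *
      ∫ x in box d n, ⟪f (x + latticeVec d u), g (x + latticeVec d u)⟫_ℂ else 0 := by
  have h_neg (p : Fin n → ℝ) : (starRingEnd ℂ) (boxChar d (-u) p) = boxChar d u p := by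
    rw [← Circle.coe_inv_eq_conj, boxChar, ← Circle.exp_neg]
    simp [boxChar, dotProduct]
  have h_inner : ⟪zakTerm d f u, zakTerm d g v⟫_ℂ = ∫ η : Phase ℝ n in cell d n,
      ⟪f (η.1 + latticeVec d u), g (η.1 + latticeVec d v)⟫_ℂ * boxChar d (u - v) η.2 := by
    rw [L2.inner_def]
    refine integral_congr_ae ?_
    filter_upwards [coeFn_zakTerm d f u, coeFn_zakTerm d g v] with η hf hg
    rw [hf, hg, RCLike.inner_apply, RCLike.inner_apply, map_mul, h_neg, sub_eq_add_neg,
      boxChar_add_left, Circle.coe_mul]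
    ring
  rw [h_inner, volume_restrict_cell, integral_prod_mul
    (fun x => ⟪f (x + latticeVec d u), g (x + latticeVec d v)⟫_ℂ)
    (fun p => (boxChar d (u - v) p : ℂ)), setIntegral_boxChar hd]
  simp only [sub_eq_zero]
  split_ifs with huv
  · rw [huv, mul_comm]
  · rw [mul_zero]

theorem pairwise_inner_zakTerm_eq_zero (hd : 0 < d) (f : Hilb n) :
    Pairwise fun u v => ⟪zakTerm d f u, zakTerm d f v⟫_ℂ = 0 :=
  fun u v huv => (inner_zakTerm hd f f u v).trans (if_neg huv)

theorem hasSum_inner_zakTerm (hd : 0 < d) (f g : Hilb n) (w : Fin n → ℤ) :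
    HasSum (fun k : Fin n → ℤ =>
        ⟪zakTerm d f (w + (d : ℤ) • k), zakTerm d g (w + (d : ℤ) • k)⟫_ℂ)
      (((d * ell d : ℝ) : ℂ) ^ n * ⟪f, g⟫_ℂ) := by
  have h_tiles := hasSum_setIntegral_box_add_latticeVec hd
    ((L2.integrable_inner (𝕜 := ℂ) f g).comp_add_right (latticeVec d w))
  rw [integral_add_right_eq_self (fun x => ⟪f x, g x⟫_ℂ), ← L2.inner_def] at h_tiles
  refine (h_tiles.mul_left _).congr_fun fun k => ?_
  simp only [inner_zakTerm hd, if_true, latticeVec_add, add_right_comm, add_assoc]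

theorem hasSum_norm_sq_zakTerm (hd : 0 < d) (f : Hilb n) :
    HasSum (fun u => ‖zakTerm d f u‖ ^ 2) ((d : ℝ) ^ n * ((d * ell d) ^ n * ‖f‖ ^ 2)) := by
  have : NeZero d := ⟨hd.ne'⟩
  have h_coset (w : Fin n → ℤ) : HasSum (fun k : Fin n → ℤ => ‖zakTerm d f (w + (d : ℤ) • k)‖ ^ 2)
      ((d * ell d) ^ n * ‖f‖ ^ 2) := by
    have h := hasSum_inner_zakTerm hd f f w
    simp only [inner_self_eq_norm_sq_to_K, RCLike.ofReal_eq_complex_ofReal] at h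
    exact Complex.hasSum_ofReal.1 (mod_cast h)
  rw [← (divModEquiv d n).symm.hasSum_iff]
  have h_summable : Summable ((fun u => ‖zakTerm d f u‖ ^ 2) ∘ (divModEquiv d n).symm) := by
    refine (summable_prod_of_nonneg fun _ => sq_nonneg _).2 ⟨fun r => ?_, .of_finite⟩
    simp only [divModEquiv_symm_apply]
    exact (h_coset _).summable
  convert h_summable.hasSum using 1
  rw [h_summable.tsum_prod]
  simp only [Function.comp_apply, divModEquiv_symm_apply, (h_coset _).tsum_eq, tsum_fintype,
    Finset.sum_const, Finset.card_univ, Fintype.card_pi, Fintype.card_fin, Finset.prod_const,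
    nsmul_eq_mul, Nat.cast_pow]

/-- The Zak transform `∑ᵤ exp(-iℓ u · p) f(q + ℓu)` of `f`, with `u` in the sublattice `Nℤⁿ`. -/
def zak (d : ℕ) (N : ℤ) (f : Hilb n) :
    Lp ℂ 2 ((volume : Measure (Phase ℝ n)).restrict (cell d n)) :=
  ∑' k : Fin n → ℤ, zakTerm d f (N • k)

variable {N : ℤ}

theorem hasSum_zak (hd : 0 < d) (hN : N ≠ 0) (f : Hilb n) :
    HasSum (fun k : Fin n → ℤ => zakTerm d f (N • k)) (zak d N f) :=
  (summable_of_pairwise_inner_eq_zero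
    ((pairwise_inner_zakTerm_eq_zero hd f).comp_of_injective (smul_right_injective _ hN))
    ((hasSum_norm_sq_zakTerm hd f).summable.comp_injective
      (smul_right_injective _ hN))).hasSum

theorem norm_sq_zak_le (hd : 0 < d) (hN : N ≠ 0) (f : Hilb n) :
    ‖zak d N f‖ ^ 2 ≤ (d : ℝ) ^ n * ((d * ell d) ^ n * ‖f‖ ^ 2) := by
  have h_inj : Function.Injective fun k : Fin n → ℤ => N • k := smul_right_injective _ hN
  have h_zak := hasSum_norm_sq_of_pairwise_inner_eq_zero
    ((pairwise_inner_zakTerm_eq_zero hd f).comp_of_injective h_inj) (hasSum_zak hd hN f)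
  have h_all := hasSum_norm_sq_zakTerm hd f
  exact hasSum_le_inj _ h_inj (fun _ _ => sq_nonneg _)
    (fun k => le_refl (‖zakTerm d f (N • k)‖ ^ 2)) h_zak h_all

end Zak

section FourierIntegral

variable {d n : ℕ}

/-- The character `η ↦ exp(iℓ[a, η])` as a bounded function on the cell. -/
def latticeCharLp (d : ℕ) (a : Phase ℤ n) :
    Lp ℂ ⊤ ((volume : Measure (Phase ℝ n)).restrict (cell d n)) :=
  (memLp_top_of_bound (continuous_latticeChar a).aestronglyMeasurable 1
    (Eventually.of_forall fun η => (Circle.norm_coe (latticeChar d a η)).le)).toLp _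

theorem coeFn_latticeCharLp (a : Phase ℤ n) :
    latticeCharLp d a =ᵐ[volume.restrict (cell d n)] fun η => (latticeChar d a η : ℂ) :=
  MemLp.coeFn_toLp _

/-- Multiplication of square-integrable functions by the character `exp(iℓ[a, η])`. -/
def latticeMul (d : ℕ) (a : Phase ℤ n) :
    Lp ℂ 2 ((volume : Measure (Phase ℝ n)).restrict (cell d n)) →L[ℂ]
      Lp ℂ 2 ((volume : Measure (Phase ℝ n)).restrict (cell d n)) :=
  (ContinuousLinearMap.mul ℂ ℂ).holderL _ ⊤ 2 2 (latticeCharLp d a)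

theorem coeFn_latticeMul (a : Phase ℤ n)
    (F : Lp ℂ 2 ((volume : Measure (Phase ℝ n)).restrict (cell d n))) :
    latticeMul d a F =ᵐ[volume.restrict (cell d n)] fun η => latticeChar d a η * F η := by
  filter_upwards [(ContinuousLinearMap.mul ℂ ℂ).coeFn_holder (r := 2) (latticeCharLp d a) F,
    coeFn_latticeCharLp a] with η h_mul h_char
  rw [latticeMul, ContinuousLinearMap.holderL_apply_apply, h_mul, h_char,
    ContinuousLinearMap.mul_apply']

/-- The unnormalised Fourier coefficient `∫ exp(-iℓ[a, η]) W(η) dη` over the cell. -/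
def fourierIntegral (d : ℕ) (a : Phase ℤ n) :
    Lp ℂ 1 ((volume : Measure (Phase ℝ n)).restrict (cell d n)) →L[ℂ] ℂ :=
  (ContinuousLinearMap.mul ℂ ℂ).lpPairing _ ⊤ 1 (latticeCharLp d (-a))

theorem fourierIntegral_apply (a : Phase ℤ n)
    (W : Lp ℂ 1 ((volume : Measure (Phase ℝ n)).restrict (cell d n))) :
    fourierIntegral d a W = ∫ η in cell d n, latticeChar d (-a) η * W η := by
  rw [fourierIntegral, ContinuousLinearMap.lpPairing_eq_integral]
  refine integral_congr_ae ?_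
  filter_upwards [coeFn_latticeCharLp (-a)] with η h_char
  rw [h_char, ContinuousLinearMap.mul_apply']

theorem fourierIntegral_star_smul (a : Phase ℤ n)
    (F G : Lp ℂ 2 ((volume : Measure (Phase ℝ n)).restrict (cell d n))) :
    fourierIntegral d a (star F • G) = ⟪F, latticeMul d (-a) G⟫_ℂ := by
  rw [fourierIntegral_apply, L2.inner_def]
  refine integral_congr_ae ?_
  filter_upwards [Lp.coeFn_lpSMul (r := 1) (star F) G, Lp.coeFn_star F,
    coeFn_latticeMul (-a) G] with η h_smul h_star h_mul
  rw [h_smul, h_mul, Pi.smul_apply', h_star, Pi.star_apply, RCLike.inner_apply, smul_eq_mul,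
    RCLike.star_def]
  ring

end FourierIntegral

section ZakProduct

variable {d n : ℕ}

theorem quasiMeasurePreserving_fst_add_latticeVec (u : Fin n → ℤ) :
    Measure.QuasiMeasurePreserving (fun η : Phase ℝ n => η.1 + latticeVec d u)
      (volume.restrict (cell d n)) volume := by
  rw [volume_restrict_cell]
  exact (measurePreserving_add_right volume (latticeVec d u)).quasiMeasurePreserving.comp
    (Measure.quasiMeasurePreserving_fst.mono_right Measure.restrict_le_self.absolutelyContinuous)

theorem latticeChar_neg_mul_boxChar_neg (a : Phase ℤ n) (w : Fin n → ℤ) (η : Phase ℝ n)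
    (s : ℝ) : latticeChar d (-a) η * boxChar d (-w) η.2 = Circle.exp (-s) *
      (boxChar d (-(w + a.1)) η.2 * Circle.exp (s + (ell d • (toReal a).2) ⬝ᵥ η.1)) := by
  have h_char : boxChar d a.2 η.1 = Circle.exp ((ell d • (toReal a).2) ⬝ᵥ η.1) := by
    rw [smul_dotProduct]
    rfl
  rw [latticeChar_eq_boxChar_mul, Prod.snd_neg, Prod.fst_neg, neg_neg, neg_add, boxChar_add_left,
    h_char, Circle.exp_neg, Circle.exp_add, eq_inv_mul_iff_mul_eq]
  ac_rfl

theorem latticeMul_neg_zakTerm (a : Phase ℤ n) (f : Hilb n) (w : Fin n → ℤ) :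
    latticeMul d (-a) (zakTerm d f w) =
      (Circle.exp (-(Real.pi * ((toReal a).1 ⬝ᵥ (toReal a).2) / d +
        (ell d • (toReal a).2) ⬝ᵥ latticeVec d w)) : ℂ) •
      zakTerm d (T d (toReal a) f) (w + a.1) := by
  refine Lp.ext ?_
  filter_upwards [coeFn_latticeMul (-a) (zakTerm d f w), coeFn_zakTerm d f w,
    Lp.coeFn_smul (Circle.exp (-(Real.pi * ((toReal a).1 ⬝ᵥ (toReal a).2) / d +
      (ell d • (toReal a).2) ⬝ᵥ latticeVec d w)) : ℂ) (zakTerm d (T d (toReal a) f) (w + a.1)),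
    coeFn_zakTerm d (T d (toReal a) f) (w + a.1),
    (quasiMeasurePreserving_fst_add_latticeVec (w + a.1)).ae (coeFn_T d (toReal a) f)]
    with η h_mul h_left h_smul h_right h_T
  have h_shift : η.1 + latticeVec d (w + a.1) - ell d • (toReal a).1 = η.1 + latticeVec d w := by
    rw [latticeVec_add, ← add_assoc]
    exact add_sub_cancel_right _ _
  rw [h_mul, h_left, h_smul, Pi.smul_apply, h_right, h_T, h_shift, smul_eq_mul,
    add_comm η.1, dotProduct_add, ← add_assoc, ← mul_assoc, ← Circle.coe_mul,
    latticeChar_neg_mul_boxChar_neg a w η (Real.pi * ((toReal a).1 ⬝ᵥ (toReal a).2) / d +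
      (ell d • (toReal a).2) ⬝ᵥ latticeVec d w)]
  simp only [Circle.coe_mul, mul_assoc]

/-- The phase in `latticeMul_neg_zakTerm` is constant along the coset `dℤⁿ - a_X`. -/
theorem exp_neg_phase_sub (hd : 0 < d) (a : Phase ℤ n) (k : Fin n → ℤ) :
    Circle.exp (-(Real.pi * ((toReal a).1 ⬝ᵥ (toReal a).2) / d +
        (ell d • (toReal a).2) ⬝ᵥ latticeVec d ((d : ℤ) • k - a.1))) =
      Circle.exp (Real.pi * ((toReal a).1 ⬝ᵥ (toReal a).2) / d) := by
  have h_ell : ell d * ell d = 2 * Real.pi / d := by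
    rw [eq_div_iff (by positivity), mul_comm, mul_ell_mul_ell hd]
  have h_dot : (ell d • (toReal a).2) ⬝ᵥ latticeVec d ((d : ℤ) • k - a.1) =
      ((a.2 ⬝ᵥ k : ℤ) : ℝ) * (2 * Real.pi) -
        2 * Real.pi / d * ((toReal a).1 ⬝ᵥ (toReal a).2) := by
    simp only [latticeVec, toReal, smul_dotProduct, dotProduct_smul, smul_eq_mul, ← mul_assoc,
      h_ell]
    simp only [dotProduct, Finset.mul_sum, Finset.sum_mul, Int.cast_sum, ← Finset.sum_sub_distrib]
    refine Finset.sum_congr rfl fun i _ => ?_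
    simp only [Pi.sub_apply, Pi.smul_apply, smul_eq_mul]
    push_cast
    field_simp
  rw [h_dot, Circle.exp_eq_exp]
  refine ⟨-(a.2 ⬝ᵥ k), ?_⟩
  push_cast
  ring

theorem inner_zakTerm_latticeMul_zak (hd : 0 < d) (a : Phase ℤ n) (f : Hilb n)
    (k : Fin n → ℤ) :
    ⟪zakTerm d f ((d : ℤ) • k), latticeMul d (-a) (zak d 1 f)⟫_ℂ =
      Circle.exp (Real.pi * ((toReal a).1 ⬝ᵥ (toReal a).2) / d) *
        ⟪zakTerm d f ((d : ℤ) • k), zakTerm d (T d (toReal a) f) ((d : ℤ) • k)⟫_ℂ := by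
  have h_zak := (hasSum_zak hd one_ne_zero f).mapL
    (innerSL ℂ (zakTerm d f ((d : ℤ) • k)) ∘L latticeMul d (-a))
  simp only [ContinuousLinearMap.comp_apply, innerSL_apply_apply, one_smul, latticeMul_neg_zakTerm,
    inner_smul_right] at h_zak
  refine h_zak.unique ?_
  convert hasSum_single ((d : ℤ) • k - a.1) fun w hw => ?_ using 1
  · rw [sub_add_cancel, exp_neg_phase_sub hd]
  · rw [inner_zakTerm hd, if_neg fun h => hw (eq_sub_of_add_eq h.symm), mul_zero]

/-- The integrable function on the cell whose Fourier coefficients are, up to a constant, the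
numbers `exp(iπ a_X · a_Z / d) ⟨f, T_a f⟩`: the product of the conjugate of the Zak transform of
`f` over the sublattice `dℤⁿ` with its Zak transform over `ℤⁿ`. -/
def zakProduct (d : ℕ) (f : Hilb n) :
    Lp ℂ 1 ((volume : Measure (Phase ℝ n)).restrict (cell d n)) :=
  star (zak d d f) • zak d 1 f

theorem norm_zakProduct_le (hd : 0 < d) (f : Hilb n) :
    ‖zakProduct d f‖ ≤ (d : ℝ) ^ n * (d * ell d) ^ n * ‖f‖ ^ 2 := by
  have h_star : ‖star (zak d d f)‖ ≤ ‖zak d d f‖ :=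
    Lp.norm_le_norm_of_ae_le ((Lp.coeFn_star _).mono fun η hη => by
      rw [hη, Pi.star_apply, norm_star])
  have h_mul : ‖zakProduct d f‖ ≤ ‖zak d d f‖ * ‖zak d 1 f‖ :=
    (Lp.norm_smul_le _ _).trans (mul_le_mul_of_nonneg_right h_star (norm_nonneg _))
  have h_d := norm_sq_zak_le hd (N := d) (by exact_mod_cast hd.ne') f
  have h_one := norm_sq_zak_le hd one_ne_zero f
  rw [mul_assoc]
  nlinarith [sq_nonneg (‖zak d d f‖ - ‖zak d 1 f‖)]

theorem fourierIntegral_zakProduct (hd : 0 < d) (a : Phase ℤ n) (f : Hilb n) :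
    fourierIntegral d a (zakProduct d f) =
      ((d * ell d : ℝ) : ℂ) ^ n *
        Circle.exp (Real.pi * ((toReal a).1 ⬝ᵥ (toReal a).2) / d) * ⟪f, T d (toReal a) f⟫_ℂ := by
  have h_zak : HasSum
      (fun k => ⟪zakTerm d f ((d : ℤ) • k), latticeMul d (-a) (zak d 1 f)⟫_ℂ)
      ⟪zak d d f, latticeMul d (-a) (zak d 1 f)⟫_ℂ :=
    (hasSum_zak hd (by exact_mod_cast hd.ne') f).mapL
      (innerSLFlip ℂ (latticeMul d (-a) (zak d 1 f)))
  simp only [inner_zakTerm_latticeMul_zak hd] at h_zak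
  have h_tiles := (hasSum_inner_zakTerm hd f (T d (toReal a) f) 0).mul_left
    (Circle.exp (Real.pi * ((toReal a).1 ⬝ᵥ (toReal a).2) / d) : ℂ)
  simp only [zero_add] at h_tiles
  rw [zakProduct, fourierIntegral_star_smul, h_zak.unique h_tiles]
  ring

end ZakProduct

/-! ### Wigner functions of states -/

section Weyl

variable {d n : ℕ}

theorem inner_T_T (b : Phase ℝ n) (f g : Hilb n) : ⟪T d b f, T d b g⟫_ℂ = ⟪f, g⟫_ℂ := by
  rw [L2.inner_def, L2.inner_def,
    ← integral_sub_right_eq_self (fun x => ⟪f x, g x⟫_ℂ) (ell d • b.1)]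
  refine integral_congr_ae ?_
  filter_upwards [coeFn_T d b f, coeFn_T d b g] with x hf hg
  rw [hf, hg, RCLike.inner_apply, RCLike.inner_apply, map_mul, ← Circle.coe_inv_eq_conj,
    mul_mul_mul_comm, ← Circle.coe_mul, mul_inv_cancel, Circle.coe_one, one_mul]

theorem T_T_comm (a b : Phase ℝ n) (f : Hilb n) :
    T d a (T d b f) = (Circle.exp (-(ell d * ell d * symp a b)) : ℂ) • T d b (T d a f) := by
  refine Lp.ext ?_
  have h_shift (c : Phase ℝ n) := (measurePreserving_sub_right volume
    (ell d • c.1)).quasiMeasurePreserving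
  filter_upwards [coeFn_T d a (T d b f), (h_shift a).ae (coeFn_T d b f),
    Lp.coeFn_smul (Circle.exp (-(ell d * ell d * symp a b)) : ℂ) (T d b (T d a f)),
    coeFn_T d b (T d a f), (h_shift b).ae (coeFn_T d a f)] with x ha hb h_smul hb' ha'
  rw [ha, hb, h_smul, Pi.smul_apply, hb', ha', smul_eq_mul, sub_right_comm x (ell d • b.1)]
  simp only [← mul_assoc, ← Circle.coe_mul, ← Circle.exp_add]
  congr 3
  simp only [symp, dotProduct_sub, smul_dotProduct, dotProduct_smul, smul_eq_mul,
    dotProduct_comm b.2 a.1]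
  ring

end Weyl

section LatticePolynomials

variable {d n : ℕ}

/-- The trigonometric polynomials on the lattice: the algebra of functions on `ℤ²ⁿ` generated by
the characters `a ↦ exp(iℓ[a, η])`, for real `η`. -/
def latticePolynomials (d n : ℕ) : Subalgebra ℂ (Phase ℤ n → ℂ) :=
  Algebra.adjoin ℂ (Set.range fun η a => (latticeChar d a η : ℂ))

theorem stdAddChar_mem_latticePolynomials (hd : 0 < d) {N : ℕ} [NeZero N] (s t : ZMod N)
    (i : Fin n) :
    (fun a : Phase ℤ n => ZMod.stdAddChar (s * (a.1 i : ZMod N) + t * (a.2 i : ZMod N))) ∈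
      latticePolynomials d n := by
  obtain ⟨s, rfl⟩ := ZMod.intCast_surjective s
  obtain ⟨t, rfl⟩ := ZMod.intCast_surjective t
  refine Algebra.subset_adjoin ⟨(-Pi.single i (2 * Real.pi * t / (N * ell d)),
    Pi.single i (2 * Real.pi * s / (N * ell d))), funext fun a => ?_⟩
  have h_cast : (s : ZMod N) * (a.1 i : ZMod N) + t * (a.2 i : ZMod N) =
      ((s * a.1 i + t * a.2 i : ℤ) : ZMod N) := by
    push_cast
    rfl
  rw [h_cast, ZMod.stdAddChar_coe]
  refine (Circle.coe_exp _).trans (congrArg Complex.exp ?_)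
  have h_ell : (ell d : ℂ) ≠ 0 := mod_cast (ell_pos hd).ne'
  simp only [symp, toReal, dotProduct_neg, dotProduct_single, sub_neg_eq_add]
  push_cast
  field_simp

/-- Fourier inversion on `ZMod N` in the variable `x`. -/
theorem stdAddChar_mul_eq_sum {N : ℕ} [NeZero N] (k x z : ZMod N) :
    ZMod.stdAddChar (k * x * z) =
      (N : ℂ)⁻¹ * ∑ r, ∑ t, ZMod.stdAddChar (-(t * r)) * ZMod.stdAddChar (t * x + k * r * z) := by
  have h_inner (r : ZMod N) :
      ∑ t, ZMod.stdAddChar (-(t * r)) * ZMod.stdAddChar (t * x + k * r * z) =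
      ((if x = r then N else 0 : ℕ) : ℂ) * ZMod.stdAddChar (k * r * z) := by
    have h_delta := AddChar.sum_mulShift (x - r) (ZMod.isPrimitive_stdAddChar N)
    simp only [sub_eq_zero, ZMod.card] at h_delta
    rw [← h_delta, Finset.sum_mul]
    refine Finset.sum_congr rfl fun t _ => ?_
    rw [← AddChar.map_add_eq_mul, ← AddChar.map_add_eq_mul]
    congr 1
    ring
  simp only [h_inner, Nat.cast_ite, Nat.cast_zero, ite_mul, zero_mul, Finset.sum_ite_eq,
    Finset.mem_univ, if_true]
  rw [inv_mul_cancel_left₀ (NeZero.ne _)]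

theorem stdAddChar_mul_mem_latticePolynomials (hd : 0 < d) {N : ℕ} [NeZero N] (k : ZMod N)
    (i : Fin n) :
    (fun a : Phase ℤ n => ZMod.stdAddChar (k * (a.1 i : ZMod N) * (a.2 i : ZMod N))) ∈
      latticePolynomials d n := by
  have h_sum : (fun a : Phase ℤ n => ZMod.stdAddChar (k * (a.1 i : ZMod N) * (a.2 i : ZMod N))) =
      (N : ℂ)⁻¹ • ∑ r : ZMod N, ∑ t : ZMod N, (ZMod.stdAddChar (-(t * r)) : ℂ) •
        fun a : Phase ℤ n => ZMod.stdAddChar (t * (a.1 i : ZMod N) + k * r * (a.2 i : ZMod N)) := by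
    ext a
    simp only [stdAddChar_mul_eq_sum k, Pi.smul_apply, Finset.sum_apply, smul_eq_mul]
  rw [h_sum]
  exact Subalgebra.smul_mem _ (sum_mem fun r _ => sum_mem fun t _ =>
    Subalgebra.smul_mem _ (stdAddChar_mem_latticePolynomials hd t (k * r) i) _) _

theorem addChar_map_sum_eq_prod {ι A M : Type*} [AddCommMonoid A] [CommMonoid M] (ψ : AddChar A M)
    (s : Finset ι) (x : ι → A) : ψ (∑ i ∈ s, x i) = ∏ i ∈ s, ψ (x i) :=
  map_sum ψ.toAddMonoidHom x s

theorem stdAddChar_dotProduct_mem_latticePolynomials (hd : 0 < d) {N : ℕ} [NeZero N]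
    (k : ZMod N) :
    (fun a : Phase ℤ n => ZMod.stdAddChar (k * ((a.1 ⬝ᵥ a.2 : ℤ) : ZMod N))) ∈
      latticePolynomials d n := by
  have h_prod : (fun a : Phase ℤ n => ZMod.stdAddChar (k * ((a.1 ⬝ᵥ a.2 : ℤ) : ZMod N))) =
      ∏ i, fun a : Phase ℤ n => ZMod.stdAddChar (k * (a.1 i : ZMod N) * (a.2 i : ZMod N)) := by
    ext a
    rw [Finset.prod_apply, ← addChar_map_sum_eq_prod, dotProduct, Int.cast_sum, Finset.mul_sum]
    simp only [Int.cast_mul, mul_assoc]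
  rw [h_prod]
  exact prod_mem fun i _ => stdAddChar_mul_mem_latticePolynomials hd k i

theorem exists_latticeSign_eq_mul (hd : 0 < d) :
    ∃ γ ∈ latticePolynomials d n, ∀ a : Phase ℤ n,
      (latticeSign a : ℂ) = γ a * Circle.exp (Real.pi * ((toReal a).1 ⬝ᵥ (toReal a).2) / d) := by
  have : NeZero (2 * d) := ⟨by positivity⟩
  refine ⟨_, stdAddChar_dotProduct_mem_latticePolynomials (N := 2 * d) hd ((d - 1 : ℤ) : ZMod _),
    fun a => ?_⟩
  have h_dot : ((a.1 ⬝ᵥ a.2 : ℤ) : ℝ) = (toReal a).1 ⬝ᵥ (toReal a).2 := by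
    simp only [dotProduct, toReal, Int.cast_sum, Int.cast_mul]
  have h_ne : (d : ℂ) ≠ 0 := mod_cast hd.ne'
  rw [← Int.cast_mul, ZMod.stdAddChar_coe, latticeSign, Circle.coe_exp, Circle.coe_exp,
    ← Complex.exp_add, ← h_dot]
  congr 1
  push_cast
  field_simp
  ring

end LatticePolynomials

section WignerMultiplier

variable {d n : ℕ} {γ γ' : Phase ℤ n → ℂ}

/-- A function `γ` on the lattice is a Wigner multiplier if, for every vector `f`, the numbers
`γ(a) ⟨f, T_a f⟩` are the Fourier coefficients of an integrable function on the cell whose norm is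
controlled by `‖f‖²`. -/
def IsWignerMultiplier (d : ℕ) (γ : Phase ℤ n → ℂ) : Prop :=
  ∃ C : ℝ, ∀ f : Hilb n, ∃ W : Lp ℂ 1 ((volume : Measure (Phase ℝ n)).restrict (cell d n)),
    ‖W‖ ≤ C * ‖f‖ ^ 2 ∧ ∀ a, fourierIntegral d a W = γ a * ⟪f, T d (toReal a) f⟫_ℂ

theorem isWignerMultiplier_exp (hd : 0 < d) : IsWignerMultiplier d fun a : Phase ℤ n =>
    ((d * ell d : ℝ) : ℂ) ^ n * Circle.exp (Real.pi * ((toReal a).1 ⬝ᵥ (toReal a).2) / d) :=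
  ⟨_, fun f => ⟨zakProduct d f, norm_zakProduct_le hd f,
    fun a => fourierIntegral_zakProduct hd a f⟩⟩

namespace IsWignerMultiplier

theorem add (h : IsWignerMultiplier d γ) (h' : IsWignerMultiplier d γ') :
    IsWignerMultiplier d (γ + γ') := by
  obtain ⟨C, hC⟩ := h
  obtain ⟨C', hC'⟩ := h'
  refine ⟨C + C', fun f => ?_⟩
  obtain ⟨W, hW, h_coeff⟩ := hC f
  obtain ⟨W', hW', h_coeff'⟩ := hC' f
  refine ⟨W + W', ?_, fun a => ?_⟩
  · rw [add_mul]
    exact norm_add_le_of_le hW hW'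
  · rw [map_add, h_coeff, h_coeff', Pi.add_apply, add_mul]

theorem const_smul (z : ℂ) (h : IsWignerMultiplier d γ) : IsWignerMultiplier d (z • γ) := by
  obtain ⟨C, hC⟩ := h
  refine ⟨‖z‖ * C, fun f => ?_⟩
  obtain ⟨W, hW, h_coeff⟩ := hC f
  refine ⟨z • W, ?_, fun a => ?_⟩
  · rw [norm_smul, mul_assoc]
    exact mul_le_mul_of_nonneg_left hW (norm_nonneg z)
  · rw [map_smul, h_coeff, Pi.smul_apply, smul_eq_mul, smul_eq_mul, mul_assoc]

/-- Displacing `f` by `-ℓ⁻¹η` multiplies `⟨f, T_a f⟩` by the character at `η`. -/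
theorem latticeChar_mul (hd : 0 < d) (η : Phase ℝ n) (h : IsWignerMultiplier d γ) :
    IsWignerMultiplier d ((fun a => (latticeChar d a η : ℂ)) * γ) := by
  obtain ⟨C, hC⟩ := h
  refine ⟨C, fun f => ?_⟩
  obtain ⟨W, hW, h_coeff⟩ := hC (T d (-(ell d)⁻¹ • η) f)
  have h_norm : ‖T d (-(ell d)⁻¹ • η) f‖ = ‖f‖ := by
    rw [norm_eq_sqrt_re_inner (𝕜 := ℂ), inner_T_T, ← norm_eq_sqrt_re_inner]
  refine ⟨W, by rwa [h_norm] at hW, fun a => ?_⟩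
  have h_phase : -(ell d * ell d * symp (toReal a) (-(ell d)⁻¹ • η)) =
      ell d * symp (toReal a) η := by
    have h_ell := (ell_pos hd).ne'
    simp only [symp, Prod.smul_fst, Prod.smul_snd, dotProduct_smul, smul_eq_mul]
    field_simp
    ring
  rw [h_coeff, T_T_comm, inner_smul_right, inner_T_T, h_phase, Pi.mul_apply, latticeChar]
  ring

theorem mul_of_mem_latticePolynomials (hd : 0 < d) {p : Phase ℤ n → ℂ}
    (hp : p ∈ latticePolynomials d n) (h : IsWignerMultiplier d γ) :
    IsWignerMultiplier d (p * γ) := by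
  induction hp using Algebra.adjoin_induction generalizing γ with
  | mem _ h_range =>
    obtain ⟨η, rfl⟩ := h_range
    exact h.latticeChar_mul hd η
  | algebraMap z =>
    rw [← Algebra.smul_def]
    exact h.const_smul z
  | add p q _ _ ihp ihq =>
    rw [add_mul]
    exact (ihp h).add (ihq h)
  | mul p q _ _ ihp ihq =>
    rw [mul_assoc]
    exact ihp (ihq h)

end IsWignerMultiplier

theorem isWignerMultiplier_latticeSign (hd : 0 < d) :
    IsWignerMultiplier d fun a : Phase ℤ n => (latticeSign a : ℂ) := by
  obtain ⟨p, hp, h_sign⟩ := exists_latticeSign_eq_mul (n := n) hd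
  have h_ne : ((d * ell d : ℝ) : ℂ) ^ n ≠ 0 :=
    pow_ne_zero _ (Complex.ofReal_ne_zero.2 (mul_ell_pos hd).ne')
  convert ((isWignerMultiplier_exp hd).mul_of_mem_latticePolynomials hd hp).const_smul
    (((d * ell d : ℝ) : ℂ) ^ n)⁻¹ using 1
  ext a
  rw [h_sign, Pi.smul_apply, Pi.mul_apply, smul_eq_mul, mul_left_comm (p a),
    inv_mul_cancel_left₀ h_ne]

theorem IsWignerMultiplier.exists_fourierIntegral_eq_trace (h : IsWignerMultiplier d γ)
    {ρ : Hilb n →L[ℂ] Hilb n} (hρ : IsState ρ) :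
    ∃ W : Lp ℂ 1 ((volume : Measure (Phase ℝ n)).restrict (cell d n)),
      ∀ a, fourierIntegral d a W = γ a * trace (ρ ∘L T d (toReal a)) := by
  obtain ⟨v, hv⟩ := hρ.exists_isMixture
  obtain ⟨C, hC⟩ := h
  choose W h_norm h_coeff using fun j => hC (v j)
  have h_summable : Summable W := .of_norm_bounded (hv.summable_norm_sq.mul_left C) h_norm
  refine ⟨∑' j, W j, fun a => (h_summable.hasSum.mapL (fourierIntegral d a)).unique ?_⟩
  simp only [h_coeff]
  exact (hv.hasSum_trace_comp _).mul_left _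

theorem IsState.exists_hasFourierSeries (hd : 0 < d) {ρ : Hilb n →L[ℂ] Hilb n} (hρ : IsState ρ) :
    ∃ W, HasFourierSeries d (phasePointCoeff fun a => trace (ρ ∘L T d (toReal a))) W := by
  obtain ⟨W, hW⟩ := ((isWignerMultiplier_latticeSign hd).const_smul
    (((d * ell d : ℝ) : ℂ) ^ (2 * n) * (1 / (2 * (Real.pi : ℂ)) ^ n)))
    |>.exists_fourierIntegral_eq_trace hρ
  refine ⟨W, L1.integrable_coeFn W, fun a => ?_⟩
  rw [← fourierIntegral_apply, hW, phasePointCoeff, Pi.smul_apply, smul_eq_mul]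
  ring

end WignerMultiplier

/-! ### Wigner functions of product states -/

section WignerFunction

variable {d n m k : ℕ}

theorem wigner_of_hasConvergentWigner {ρ : Hilb n →L[ℂ] Hilb n} (h : HasConvergentWigner d ρ) :
    wigner d ρ = fourierSum d (phasePointCoeff fun a => trace (ρ ∘L T d (toReal a))) := by
  rw [wigner, if_pos h]
  exact funext fun η => const_mul_tsum_phaseCoeff_mul d η _

theorem hasWignerSeries_iff {ρ : Hilb n →L[ℂ] Hilb n} {W : Phase ℝ n → ℂ} :
    HasWignerSeries d ρ W ↔
      HasFourierSeries d (phasePointCoeff fun a => trace (ρ ∘L T d (toReal a))) W := by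
  have h_char (a : Phase ℤ n) (η : Phase ℝ n) :
      Complex.exp (-(Complex.I * ((ell d * symp (toReal a) η : ℝ) : ℂ))) =
        latticeChar d (-a) η := by
    rw [← mul_neg, ← Complex.ofReal_neg, exp_I_mul_ofReal, latticeChar]
    simp only [symp, toReal, dotProduct, Prod.fst_neg, Prod.snd_neg, Pi.neg_apply, Int.cast_neg,
      neg_mul, Finset.sum_neg_distrib, sub_neg_eq_add, neg_add_eq_sub, mul_sub, neg_sub]
  simp only [HasWignerSeries, HasFourierSeries, h_char, exp_I_mul_ofReal, phasePointCoeff,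
    latticeSign]

theorem hasFourierSeries_wigner (hd : 0 < d) {ρ : Hilb n →L[ℂ] Hilb n}
    (h : ∃ W, HasFourierSeries d (phasePointCoeff fun a => trace (ρ ∘L T d (toReal a))) W) :
    HasFourierSeries d (phasePointCoeff fun a => trace (ρ ∘L T d (toReal a))) (wigner d ρ) := by
  by_cases h_conv : HasConvergentWigner d ρ
  · rw [wigner_of_hasConvergentWigner h_conv]
    exact hasFourierSeries_fourierSum hd (summable_phasePointCoeff h_conv)
  · simp only [← hasWignerSeries_iff] at h ⊢
    rw [wigner, if_neg h_conv, dif_pos h]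
    exact h.choose_spec

variable {ρ : Hilb m →L[ℂ] Hilb m} {σ : Hilb k →L[ℂ] Hilb k}

theorem HasConvergentWigner.tensorOp (hρ : IsState ρ) (hσ : IsState σ)
    (h : HasConvergentWigner d ρ) (h' : HasConvergentWigner d σ) :
    HasConvergentWigner d (tensorOp ρ σ) := by
  simp only [HasConvergentWigner, trace_tensorOp_T hρ hσ]
  exact summable_mul_modes (u := fun a => trace (ρ ∘L T d (toReal a)))
    (v := fun a => trace (σ ∘L T d (toReal a))) h h'

theorem wigner_tensorOp (hρ : IsState ρ) (hσ : IsState σ) (h : HasConvergentWigner d ρ)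
    (h' : HasConvergentWigner d σ) (η : Phase ℝ (m + k)) :
    wigner d (tensorOp ρ σ) η = wigner d ρ (fstModes η) * wigner d σ (sndModes η) := by
  rw [wigner_of_hasConvergentWigner h, wigner_of_hasConvergentWigner h',
    wigner_of_hasConvergentWigner (h.tensorOp hρ hσ h'),
    ← fourierSum_phasePointCoeff_mul_modes d h h']
  simp only [trace_tensorOp_T hρ hσ]

theorem wigner_tensorOp_ae_eq (hd : 0 < d) (hρ : IsState ρ) (hσ : IsState σ) :
    ∀ᵐ η ∂(volume.restrict (cell d (m + k))),
      wigner d (tensorOp ρ σ) η = wigner d ρ (fstModes η) * wigner d σ (sndModes η) := by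
  have h_product := (hasFourierSeries_wigner hd (hρ.exists_hasFourierSeries hd)).mul_modes
    (hasFourierSeries_wigner hd (hσ.exists_hasFourierSeries hd))
  simp only [← phasePointCoeff_modes, ← trace_tensorOp_T hρ hσ] at h_product
  exact (hasFourierSeries_wigner hd ⟨_, h_product⟩).ae_eq hd h_product

theorem negativity_tensorOp (hd : 0 < d) (hρ : IsState ρ) (hσ : IsState σ) :
    negativity d (tensorOp ρ σ) = negativity d ρ * negativity d σ := by
  rw [negativity, negativity, negativity,
    ← setIntegral_cell_mul_modes d (fun η => ‖wigner d ρ η‖) fun η => ‖wigner d σ η‖]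
  refine integral_congr_ae ?_
  filter_upwards [wigner_tensorOp_ae_eq hd hρ hσ] with η h_eq
  rw [h_eq, norm_mul]

end WignerFunction

end ZakGross

end

open ZakGross in
theorem mainTheorem5_general (d : ℕ) (hd : 0 < d) (m k : ℕ) :
    (∀ (n : ℕ) (φ ψ : 𝓢(Fin n → ℝ, ℂ)), InFormDomain d (φ.toLp 2) (ψ.toLp 2)) ∧
    (∀ (f₁ g₁ : Hilb m) (f₂ g₂ : Hilb k), InFormDomain d f₁ g₁ → InFormDomain d f₂ g₂ →
      InFormDomain d (tensorVec f₁ f₂) (tensorVec g₁ g₂) ∧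
      ∀ η : Phase ℝ (m + k),
        phasePoint d η (tensorVec f₁ f₂) (tensorVec g₁ g₂) =
          phasePoint d (fstModes η) f₁ g₁ * phasePoint d (sndModes η) f₂ g₂) ∧
    (∀ F G : Hilb (m + k), InFormDomain d F G → ∀ η : Phase ℝ (m + k),
      Tendsto (fun S : Finset (Phase ℤ m) × Finset (Phase ℤ k) =>
          ⟪F, tensorOp (phasePointTrunc d (fstModes η) S.1)
            (phasePointTrunc d (sndModes η) S.2) G⟫_ℂ)
        atTop (𝓝 (phasePoint d η F G))) ∧
    ∀ (ρ : Hilb m →L[ℂ] Hilb m) (σ : Hilb k →L[ℂ] Hilb k), IsState ρ → IsState σ →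
      (HasConvergentWigner d ρ → HasConvergentWigner d σ →
        HasConvergentWigner d (tensorOp ρ σ) ∧
        ∀ η : Phase ℝ (m + k),
          wigner d (tensorOp ρ σ) η = wigner d ρ (fstModes η) * wigner d σ (sndModes η)) ∧
      (∀ᵐ η ∂(volume.restrict (cell d (m + k))),
        wigner d (tensorOp ρ σ) η = wigner d ρ (fstModes η) * wigner d σ (sndModes η)) ∧
      negativity d (tensorOp ρ σ) = negativity d ρ * negativity d σ := by
  refine ⟨fun n φ ψ => inFormDomain_schwartz hd φ ψ, fun f₁ g₁ f₂ g₂ h₁ h₂ =>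
    ⟨inFormDomain_tensorVec h₁ h₂, phasePoint_tensorVec h₁ h₂⟩,
    fun F G h η => tendsto_inner_tensorOp_phasePointTrunc h η, fun ρ σ hρ hσ =>
    ⟨fun h h' => ⟨h.tensorOp hρ hσ h', wigner_tensorOp hρ hσ h h'⟩,
      wigner_tensorOp_ae_eq hd hρ hσ, negativity_tensorOp hd hρ hσ⟩⟩

open ZakGross in
theorem mainTheorem5 (d : ℕ) (hd : Odd d) (m k : ℕ) :
    -- the phase-point operators are well defined on Schwartz functions
    (∀ (n : ℕ) (φ ψ : 𝓢(Fin n → ℝ, ℂ)), InFormDomain d (φ.toLp 2) (ψ.toLp 2)) ∧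
    -- `A_η = A_{η⁽¹⁾} ⊗ A_{η⁽²⁾}` : matrix elements between product vectors
    (∀ (f₁ g₁ : Hilb m) (f₂ g₂ : Hilb k), InFormDomain d f₁ g₁ → InFormDomain d f₂ g₂ →
      InFormDomain d (tensorVec f₁ f₂) (tensorVec g₁ g₂) ∧
      ∀ η : Phase ℝ (m + k),
        phasePoint d η (tensorVec f₁ f₂) (tensorVec g₁ g₂) =
          phasePoint d (fstModes η) f₁ g₁ * phasePoint d (sndModes η) f₂ g₂) ∧
    -- `A_η = A_{η⁽¹⁾} ⊗ A_{η⁽²⁾}` : all matrix elements, as limits of tensor products of truncations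
    (∀ F G : Hilb (m + k), InFormDomain d F G → ∀ η : Phase ℝ (m + k),
      Tendsto (fun S : Finset (Phase ℤ m) × Finset (Phase ℤ k) =>
          ⟪F, tensorOp (phasePointTrunc d (fstModes η) S.1)
            (phasePointTrunc d (sndModes η) S.2) G⟫_ℂ)
        atTop (𝓝 (phasePoint d η F G))) ∧
    ∀ (ρ : Hilb m →L[ℂ] Hilb m) (σ : Hilb k →L[ℂ] Hilb k), IsState ρ → IsState σ →
      -- `W_{ρ ⊗ σ}(η) = W_ρ(η⁽¹⁾) W_σ(η⁽²⁾)`, at every `η` if the defining series converge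
      (HasConvergentWigner d ρ → HasConvergentWigner d σ →
        HasConvergentWigner d (tensorOp ρ σ) ∧
        ∀ η : Phase ℝ (m + k),
          wigner d (tensorOp ρ σ) η = wigner d ρ (fstModes η) * wigner d σ (sndModes η)) ∧
      -- and for all states at almost every `η`
      (∀ᵐ η ∂(volume.restrict (cell d (m + k))),
        wigner d (tensorOp ρ σ) η = wigner d ρ (fstModes η) * wigner d σ (sndModes η)) ∧
      -- the negativity is multiplicative
      negativity d (tensorOp ρ σ) = negativity d ρ * negativity d σ := by
  exact mainTheorem5_general d hd.pos m k
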